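/- Let $\eta$ be a random variable with values in $\{0,1,2,\dots\}$ and let $d\ge 2$. Consider the frog model on the nearest-neighbour graph $\mathbb Z^d$ with survival parameter $p\in[0,1]$: the initial numbers of particles $\eta(x)$, $x\in\mathbb Z^d$, are i.i.d. copies of $\eta$; the $i$-th particle from $x$ ($1\le i\le\eta(x)$) has a simple random walk $(S^x_n(i))_{n\ge0}$ on $\mathbb Z^d$ started at $x$ and a lifetime $\Xi^x_p(i)$ with $\mathbf P[\Xi^x_p(i)=k]=(1-p)p^{k-1}$, $k=1,2,\dots$ (and $\Xi^x_p(i)=\infty$ if $p=1$), all these variables being independent. Let $t(x,y)=\min_{1\le i\le\eta(x)}\min\{n<\Xi^x_p(i): S^x_n(i)=y\}$ (with $\min\emptyset=\infty$), and let the activation time of $x$ be $T(x)=\inf\{t(x_0,x_1)+\dots+t(x_{m-1},x_m)\}$, the infimum being over all finite sequences $0=x_0,x_1,\dots,x_m=x$, $m\ge0$, so that $T(0)=0$. The $i$-th particle from $x$ is active at time $n$ if $T(x)\le n<T(x)+\Xi^x_p(i)$, and the model survives if at every time $n=0,1,2,\dots$ at least one particle is active. Let $$p_c(\mathbb Z^d,\eta)=\inf\{p\in[0,1]:\mathbf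 P[\text{the model with parameter } p \text{ survives}]>0\}$$ (with $\inf\emptyset=1$). If $\mathbf P[\eta\ge1]>0$, then $p_c(\mathbb Z^d,\eta)<1$; moreover there is $p_0<1$ such that the model survives with positive probability for every $p\in(p_0,1]$. -/

import Mathlib

namespace FrogModel

open MeasureTheory ProbabilityTheory

noncomputable section

/-- The vertices of the lattice `ℤ^d`. -/
abbrev Site (d : ℕ) : Type := Fin d → ℤ

/-- The neighbours of the origin in the nearest-neighbour graph on `ℤ^d`. -/
def unitSteps (d : ℕ) : Set (Site d) := {e | ∑ j, |e j| = 1}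

/-- The law of one step of simple random walk on `ℤ^d`: uniform on the `2d` neighbours of `0`. -/
def stepLaw (d : ℕ) : Measure (Site d) := uniformOn (unitSteps d)

/-- The law of a lifetime `Ξ` with survival parameter `p`: for `p < 1`,
`P[Ξ = k + 1] = (1 - p) p ^ k` for `k = 0, 1, 2, …`; for `p = 1` there is no death, `Ξ = ∞`. -/
def lifetimeLaw (p : unitInterval) : Measure ℕ∞ :=
  if p < 1 then
    Measure.sum fun k : ℕ =>
      ENNReal.ofReal ((1 - (p : ℝ)) * (p : ℝ) ^ k) • Measure.dirac ((k + 1 : ℕ) : ℕ∞)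
  else Measure.dirac ⊤

/-- A realization of all the randomness. The particles with original position `x` are
`(x, 0), …, (x, count x - 1)`; the variables of the other pairs `(x, i)` are not used. -/
abbrev Config (d : ℕ) : Type :=
  (Site d → ℕ) × (Site d × ℕ × ℕ → Site d) × (Site d × ℕ → ℕ∞)

/-- The initial number of particles at `x`. -/
def count {d : ℕ} (ω : Config d) (x : Site d) : ℕ := ω.1 x

/-- The position after `n` steps of the walk of the `i`-th particle from `x`. -/
def walk {d : ℕ} (ω : Config d) (x : Site d) (i n : ℕ) : Site d :=
  x + ∑ k ∈ Finset.range n, ω.2.1 (x, i, k)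

/-- The lifetime, counted from its activation, of the `i`-th particle from `x`. -/
def lifetime {d : ℕ} (ω : Config d) (x : Site d) (i : ℕ) : ℕ∞ := ω.2.2 (x, i)

/-- The law of the frog model on `ℤ^d` with survival parameter `p`, when the initial number of
particles at a site has law `ν`: all the variables are independent. -/
def law (d : ℕ) (ν : Measure ℕ) (p : unitInterval) : Measure (Config d) :=
  (Measure.infinitePi fun _ : Site d => ν).prod
    ((Measure.infinitePi fun _ : Site d × ℕ × ℕ => stepLaw d).prod
      (Measure.infinitePi fun _ : Site d × ℕ => lifetimeLaw p))

/-- The time that the particles from `x` need, once activated, to visit `y`; it is `⊤` if none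
of them does before it dies. -/
def hitTime {d : ℕ} (ω : Config d) (x y : Site d) : ℕ∞ :=
  ⨅ (i : ℕ) (n : ℕ) (_ : i < count ω x ∧ (n : ℕ∞) < lifetime ω x i ∧ walk ω x i n = y), (n : ℕ∞)

/-- The time at which the particles at `x` are activated: the infimum of
`t(x₀,x₁) + ⋯ + t(x_{m-1},x_m)` over the finite sequences `0 = x₀, …, x_m = x`, `m ≥ 0`. -/
def activationTime {d : ℕ} (ω : Config d) (x : Site d) : ℕ∞ :=
  ⨅ (m : ℕ) (z : Fin (m + 1) → Site d) (_ : z 0 = 0 ∧ z (Fin.last m) = x),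
    ∑ j : Fin m, hitTime ω (z j.castSucc) (z j.succ)

/-- The `i`-th particle from `x` exists and is active at time `n`. -/
def IsActive {d : ℕ} (ω : Config d) (x : Site d) (i n : ℕ) : Prop :=
  i < count ω x ∧ activationTime ω x ≤ n ∧ (n : ℕ∞) < activationTime ω x + lifetime ω x i

/-- The realization survives: at every time there is an active particle. -/
def Survives {d : ℕ} (ω : Config d) : Prop := ∀ n : ℕ, ∃ x i, IsActive ω x i n

/-- The probability that the frog model on `ℤ^d` survives. -/
def survivalProb (d : ℕ) (ν : Measure ℕ) (p : unitInterval) : ENNReal :=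
  law d ν p {ω | Survives ω}

/-- The critical parameter: the infimum, within `[0, 1]`, of the parameters for which survival has
positive probability. The infimum of the empty set is `1`. -/
def criticalParam (d : ℕ) (ν : Measure ℕ) : unitInterval :=
  sInf {p : unitInterval | 0 < survivalProb d ν p}

theorem finite_unitSteps (d : ℕ) : (unitSteps d).Finite := by
  refine (Set.finite_Icc (fun _ : Fin d => (-1 : ℤ)) (fun _ => 1)).subset fun e he => ?_
  have h : ∀ j, |e j| ≤ 1 := fun j =>
    (Finset.single_le_sum (fun i _ => abs_nonneg (e i)) (Finset.mem_univ j)).trans_eq he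
  exact ⟨fun j => (abs_le.1 (h j)).1, fun j => (abs_le.1 (h j)).2⟩

theorem nonempty_unitSteps {d : ℕ} (hd : 0 < d) : (unitSteps d).Nonempty := by
  refine ⟨Pi.single ⟨0, hd⟩ 1, ?_⟩
  show ∑ j, |(Pi.single (⟨0, hd⟩ : Fin d) (1 : ℤ) : Site d) j| = 1
  rw [Finset.sum_eq_single (⟨0, hd⟩ : Fin d)] <;> simp +contextual

theorem isProbabilityMeasure_stepLaw {d : ℕ} (hd : 0 < d) :
    IsProbabilityMeasure (stepLaw d) :=
  isProbabilityMeasure_uniformOn (finite_unitSteps d) (nonempty_unitSteps hd)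

instance isProbabilityMeasure_lifetimeLaw (p : unitInterval) :
    IsProbabilityMeasure (lifetimeLaw p) := by
  unfold lifetimeLaw
  split_ifs with h
  · have hp : (p : ℝ) < 1 := h
    have hs := (hasSum_geometric_of_lt_one p.2.1 hp).mul_left (1 - (p : ℝ))
    rw [mul_inv_cancel₀ (by linarith)] at hs
    refine ⟨?_⟩
    rw [Measure.sum_apply _ MeasurableSet.univ]
    simp only [Measure.smul_apply, measure_univ, smul_eq_mul, mul_one]
    rw [← ENNReal.ofReal_tsum_of_nonneg
      (fun k => mul_nonneg (by linarith) (pow_nonneg p.2.1 k)) hs.summable, hs.tsum_eq,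
      ENNReal.ofReal_one]
  · infer_instance

end

end FrogModel

/-!
Use only the first particle of each site and only the first `N` steps of its walk, and only if it
lives longer than `N`. The variables of distinct sites are then independent, and the model
survives as soon as infinitely many sites can be reached from the origin through such visits.

Project to a coordinate plane and divide it into square blocks. If the set of reached sites is
finite, its projection to the blocks is a finite connected set, and its boundary contains a chain
of `k + 1` distinct edges that starts at the edge from `(k, 0)` to `(k + 1, 0)`, for some `k`.
There are at most `36 ^ k` such chains. If the block side is at least `36 * L` and the particle of
the origin walks straight out of its neighbourhood, then there are at least `(k + 1) * L` reached
sites near the chain, and none of their particles enters the block beyond the nearby edge. By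
comparison with a Gaussian subsolution, each of these failures has probability at most `β < 1`,
where `β` does not depend on the block side. Exploring the cluster site by site shows that the
failures cost a factor `β ^ ((k + 1) * L)`, and for large `L` the sum over all chains converges to
less than one.
-/

namespace FrogModel

open MeasureTheory ProbabilityTheory

noncomputable section

section Planar

/-- Steps from `x` to `y` by an element of `S` which stay inside `C`: the adjacency relation of
the subgraph that `C` induces in the Cayley graph with generating set `S`. -/
def StepIn {G : Type*} [AddGroup G] (S C : Set G) (x y : G) : Prop :=
  x ∈ C ∧ y ∈ C ∧ y - x ∈ S

/-- Every point of `C` can be reached from the origin by steps in `S` which stay inside `C`. -/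
def IsStepConnected {G : Type*} [AddGroup G] (S C : Set G) : Prop :=
  ∀ y ∈ C, Relation.ReflTransGen (StepIn S C) 0 y

/-- The four nearest-neighbour directions of the planar lattice. -/
def planarSteps : Finset (ℤ × ℤ) := {(1, 0), (-1, 0), (0, 1), (0, -1)}

theorem mem_planarSteps {u : ℤ × ℤ} :
    u ∈ planarSteps ↔ u = (1, 0) ∨ u = (-1, 0) ∨ u = (0, 1) ∨ u = (0, -1) := by
  simp [planarSteps]

theorem neg_mem_planarSteps {u : ℤ × ℤ} (hu : u ∈ planarSteps) : -u ∈ planarSteps := by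
  simp only [mem_planarSteps, Prod.ext_iff, Prod.fst_neg, Prod.snd_neg] at hu ⊢
  omega

theorem eq_of_forall_eq_succ {α : Type*} {f : ℤ → α} {a b : ℤ} (hab : a ≤ b)
    (h : ∀ j, a ≤ j → j < b → f j = f (j + 1)) : f a = f b := by
  induction b, hab using Int.leInduction with
  | base => rfl
  | succ b hb ih =>
    exact (ih fun j hj hjb => h j hj (by omega)).trans (h b hb (by omega))

theorem eq_of_forall_planarSteps {G : Type*} [AddCommGroup G] {g : ℤ × ℤ → G}
    {F : ℤ × ℤ → ℤ × ℤ → G} (hanti : ∀ u v, F v u = -F u v)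
    (hright : ∀ x y, g (x, y) - g (x + 1, y) = F (x, y) (x + 1, y))
    (hup : ∀ x y, g (x, y) - g (x, y + 1) = F (x, y) (x, y + 1)) {u v : ℤ × ℤ}
    (huv : v - u ∈ planarSteps) : g u - g v = F u v := by
  obtain ⟨e, rfl⟩ : ∃ e, v = u + e := ⟨v - u, by abel⟩
  rw [add_sub_cancel_left] at huv
  obtain ⟨x, y⟩ := u
  rcases mem_planarSteps.1 huv with rfl | rfl | rfl | rfl
  · simpa using hright x y
  · simpa [← hanti, sub_eq_add_neg] using congrArg Neg.neg (hright (x - 1) y)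
  · simpa using hup x y
  · simpa [← hanti, sub_eq_add_neg] using congrArg Neg.neg (hup x (y - 1))

theorem exists_potential {G : Type*} [AddCommGroup G] {F : ℤ × ℤ → ℤ × ℤ → G}
    (hanti : ∀ u v, F v u = -F u v)
    (hclosed : ∀ x y, F (x, y) (x + 1, y) + F (x + 1, y) (x + 1, y + 1) =
      F (x, y) (x, y + 1) + F (x, y + 1) (x + 1, y + 1))
    {M : ℤ} (hbox : ∀ u v, M ≤ |u.1| ∨ M ≤ |u.2| → F u v = 0) :
    ∃ g : ℤ × ℤ → G, (∀ u v, v - u ∈ planarSteps → g u - g v = F u v) ∧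
      ∀ u, M ≤ |u.1| → g u = 0 := by
  set g : ℤ × ℤ → G := fun u => ∑ j ∈ Finset.Ico u.1 M, F (j, u.2) (j + 1, u.2) with hg
  have hg_right : ∀ x y, M ≤ x → g (x, y) = 0 := fun x y hx => by
    simp only [hg, Finset.Ico_eq_empty (not_lt.2 hx), Finset.sum_empty]
  have hg_top : ∀ x y, M ≤ y → g (x, y) = 0 := fun x y hy =>
    Finset.sum_eq_zero fun j _ => hbox _ _ (Or.inr (hy.trans (le_abs_self _)))
  have hright : ∀ x y, g (x, y) - g (x + 1, y) = F (x, y) (x + 1, y) := by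
    intro x y
    rcases lt_or_ge x M with h | h
    · simp only [hg, ← Finset.insert_Ico_add_one_left_eq_Ico h]
      rw [Finset.sum_insert (by simp), add_sub_cancel_right]
    · rw [hg_right x y h, hg_right _ y (by omega),
        hbox _ _ (Or.inl (h.trans (le_abs_self x))), sub_zero]
  have hup : ∀ x y, g (x, y) - g (x, y + 1) = F (x, y) (x, y + 1) := by
    intro x y
    rw [← sub_eq_zero]
    refine (eq_of_forall_eq_succ
      (f := fun x => g (x, y) - g (x, y + 1) - F (x, y) (x, y + 1)) (le_max_left x M)
      fun j _ _ => ?_).trans ?_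
    · rw [← sub_eq_zero, ← sub_eq_zero.2 (hclosed j y), ← hright j y, ← hright j (y + 1)]
      abel
    · simp only [hg_right _ _ (le_max_right x M)]
      rw [hbox _ _ (Or.inl ((le_max_right x M).trans (le_abs_self _))), sub_zero, sub_zero]
  refine ⟨g, fun u v => eq_of_forall_planarSteps hanti hright hup, fun ⟨x, y⟩ hx => ?_⟩
  have hconst : g (x, y) = g (x, max y M) :=
    eq_of_forall_eq_succ (f := fun y => g (x, y)) (le_max_left y M) fun j _ _ =>
      sub_eq_zero.1 ((hup x j).trans (hbox _ _ (Or.inl hx)))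
  exact hconst.trans (hg_top _ _ (le_max_right y M))

/-- Oriented pairs of points of the planar lattice. -/
abbrev PlanarEdge : Type := (ℤ × ℤ) × (ℤ × ℤ)

/-- `e` is an edge of the planar lattice that leaves `D`. -/
def IsBoundaryEdge (D : Set (ℤ × ℤ)) (e : PlanarEdge) : Prop :=
  e.1 ∈ D ∧ e.2 ∉ D ∧ e.2 - e.1 ∈ planarSteps

/-- `u` is one of the corners of the unit square with lower left corner `s`. -/
def InSquare (s u : ℤ × ℤ) : Prop :=
  (u.1 = s.1 ∨ u.1 = s.1 + 1) ∧ (u.2 = s.2 ∨ u.2 = s.2 + 1)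

/-- Distinct boundary edges of `D` are adjacent if they lie on a common unit square: the contours
around `D` are the connected components of this graph. -/
def boundaryGraph (D : Set (ℤ × ℤ)) : SimpleGraph PlanarEdge where
  Adj e f := e ≠ f ∧ IsBoundaryEdge D e ∧ IsBoundaryEdge D f ∧
    ∃ s, InSquare s e.1 ∧ InSquare s e.2 ∧ InSquare s f.1 ∧ InSquare s f.2
  symm := ⟨fun _ _ ⟨h, he, hf, s, h1, h2, h3, h4⟩ => ⟨h.symm, hf, he, s, h3, h4, h1, h2⟩⟩
  loopless := ⟨fun _ h => h.1 rfl⟩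

/-- The number of edges of `K` from `u` to `v`, counted with sign: the discrete one-form dual to
the contour `K`, which integrates to the number of crossings of `K` along a path. -/
def flux (K : Set PlanarEdge) (u v : ℤ × ℤ) : ℤ :=
  K.indicator 1 (u, v) - K.indicator 1 (v, u)

theorem flux_swap (K : Set PlanarEdge) (u v : ℤ × ℤ) : flux K v u = -flux K u v :=
  (neg_sub _ _).symm

theorem mem_or_swap_mem_of_flux_ne_zero {K : Set PlanarEdge} {u v : ℤ × ℤ} (h : flux K u v ≠ 0) :
    (u, v) ∈ K ∨ (v, u) ∈ K := by
  contrapose! h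
  simp [flux, h.1, h.2]

theorem flux_eq_one {D : Set (ℤ × ℤ)} {K : Set PlanarEdge} (hK : ∀ e ∈ K, IsBoundaryEdge D e)
    {u v : ℤ × ℤ} (h : (u, v) ∈ K) : flux K u v = 1 := by
  have hswap : (v, u) ∉ K := fun h' => (hK _ h).2.1 (hK _ h').1
  simp [flux, h, hswap]

theorem flux_eq_zero {D : Set (ℤ × ℤ)} {K : Set PlanarEdge} (hK : ∀ e ∈ K, IsBoundaryEdge D e)
    {u v : ℤ × ℤ} (h : u ∈ D ↔ v ∈ D) : flux K u v = 0 := by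
  by_contra hne
  rcases mem_or_swap_mem_of_flux_ne_zero hne with hmem | hmem
  · exact (hK _ hmem).2.1 (h.1 (hK _ hmem).1)
  · exact (hK _ hmem).2.1 (h.2 (hK _ hmem).1)

/-- The edges of the component of `e₀` in the boundary graph of `D`. -/
def contour (D : Set (ℤ × ℤ)) (e₀ : PlanarEdge) : Set PlanarEdge :=
  {e | IsBoundaryEdge D e ∧ (boundaryGraph D).Reachable e₀ e}

theorem mem_contour_of_inSquare {D : Set (ℤ × ℤ)} {e₀ e f : PlanarEdge} (he : e ∈ contour D e₀)
    (hf : IsBoundaryEdge D f) {s : ℤ × ℤ} (h1 : InSquare s e.1) (h2 : InSquare s e.2)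
    (h3 : InSquare s f.1) (h4 : InSquare s f.2) : f ∈ contour D e₀ := by
  rcases eq_or_ne e f with rfl | hef
  · exact he
  · exact ⟨hf, he.2.trans (SimpleGraph.Adj.reachable ⟨hef, he.1, hf, s, h1, h2, h3, h4⟩)⟩

theorem flux_contour_eq_indicator_sub {D : Set (ℤ × ℤ)} {e₀ e : PlanarEdge} {s u v : ℤ × ℤ}
    (he : e ∈ contour D e₀) (h1 : InSquare s e.1) (h2 : InSquare s e.2) (hu : InSquare s u)
    (hv : InSquare s v) (huv : v - u ∈ planarSteps) :
    flux (contour D e₀) u v = D.indicator 1 u - D.indicator 1 v := by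
  have hboundary : ∀ f ∈ contour D e₀, IsBoundaryEdge D f := fun _ h => h.1
  have hmem : ∀ {u v}, u ∈ D → v ∉ D → v - u ∈ planarSteps → InSquare s u → InSquare s v →
      flux (contour D e₀) u v = 1 := fun hu' hv' huv hu hv =>
    flux_eq_one hboundary (mem_contour_of_inSquare he ⟨hu', hv', huv⟩ h1 h2 hu hv)
  by_cases hu' : u ∈ D <;> by_cases hv' : v ∈ D
  · simp [flux_eq_zero hboundary (iff_of_true hu' hv'), hu', hv']
  · simp [hmem hu' hv' huv hu hv, hu', hv']
  · have hvu : u - v ∈ planarSteps := by simpa using neg_mem_planarSteps huv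
    rw [← neg_neg (flux _ u v), ← flux_swap, hmem hv' hu' hvu hv hu]
    simp [hu', hv']
  · simp [flux_eq_zero hboundary (iff_of_false hu' hv'), hu', hv']

theorem flux_contour_closed (D : Set (ℤ × ℤ)) (e₀ : PlanarEdge) (x y : ℤ) :
    flux (contour D e₀) (x, y) (x + 1, y) + flux (contour D e₀) (x + 1, y) (x + 1, y + 1) =
      flux (contour D e₀) (x, y) (x, y + 1) +
        flux (contour D e₀) (x, y + 1) (x + 1, y + 1) := by
  have q1 : InSquare (x, y) (x, y) := by simp [InSquare]
  have q2 : InSquare (x, y) (x + 1, y) := by simp [InSquare]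
  have q3 : InSquare (x, y) (x, y + 1) := by simp [InSquare]
  have q4 : InSquare (x, y) (x + 1, y + 1) := by simp [InSquare]
  by_cases hs : ∃ e ∈ contour D e₀, InSquare (x, y) e.1 ∧ InSquare (x, y) e.2
  · obtain ⟨e, he, h1, h2⟩ := hs
    have hflux := fun {u v} => flux_contour_eq_indicator_sub (u := u) (v := v) he h1 h2
    rw [hflux q1 q2 (by simp [planarSteps]), hflux q2 q4 (by simp [planarSteps]),
      hflux q1 q3 (by simp [planarSteps]), hflux q3 q4 (by simp [planarSteps])]
    abel
  · push Not at hs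
    have hflux : ∀ {u v}, InSquare (x, y) u → InSquare (x, y) v → flux (contour D e₀) u v = 0 := by
      intro u v hu hv
      by_contra hne
      rcases mem_or_swap_mem_of_flux_ne_zero hne with h | h
      · exact hs _ h hu hv
      · exact hs _ h hv hu
    rw [hflux q1 q2, hflux q2 q4, hflux q1 q3, hflux q3 q4]

theorem exists_max_mem_axis {D : Set (ℤ × ℤ)} (hfin : D.Finite) (h0 : 0 ∈ D) :
    ∃ k : ℕ, ((k : ℤ), (0 : ℤ)) ∈ D ∧ ∀ j : ℤ, k < j → (j, (0 : ℤ)) ∉ D := by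
  have hf : {j : ℕ | ((j : ℤ), (0 : ℤ)) ∈ D}.Finite :=
    hfin.preimage (f := fun j : ℕ => ((j : ℤ), (0 : ℤ))) fun a _ b _ h => by simpa using h
  obtain ⟨k, hk, hmax⟩ := hf.exists_maximal ⟨0, h0⟩
  refine ⟨k, hk, fun j hj hjD => ?_⟩
  lift j to ℕ using by omega
  exact absurd (hmax hjD (by omega)) (by omega)

theorem exists_potential_contour {D : Set (ℤ × ℤ)} (hfin : D.Finite) (e₀ : PlanarEdge) :
    ∃ (M : ℤ) (g : ℤ × ℤ → ℤ),
      (∀ u v, v - u ∈ planarSteps → g u - g v = flux (contour D e₀) u v) ∧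
      ∀ u, M ≤ |u.1| → g u = 0 := by
  obtain ⟨M, hM⟩ : ∃ M : ℤ, ∀ e ∈ contour D e₀,
      (|e.1.1| < M ∧ |e.1.2| < M) ∧ |e.2.1| < M ∧ |e.2.2| < M := by
    obtain ⟨a, ha⟩ := (hfin.image fun u => |u.1| + |u.2|).bddAbove
    refine ⟨a + 2, fun e he => ?_⟩
    have h1 := ha (Set.mem_image_of_mem _ he.1.1)
    have h2 := he.1.2.2
    simp only [mem_planarSteps, Prod.ext_iff, Prod.fst_sub, Prod.snd_sub] at h1 h2
    grind
  refine ⟨M, exists_potential (flux_swap _) (flux_contour_closed D e₀) fun u v h => ?_⟩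
  by_contra hne
  rcases mem_or_swap_mem_of_flux_ne_zero hne with hmem | hmem <;>
    · have := hM _ hmem
      simp only at this
      omega

theorem exists_reachable_boundaryEdge {D : Set (ℤ × ℤ)} (hfin : D.Finite) (h0 : 0 ∈ D)
    (hconn : IsStepConnected planarSteps D) :
    ∃ k : ℕ, ∃ f, IsBoundaryEdge D ((k, 0), (k + 1, 0)) ∧ f.1.1 ≤ 0 ∧
      (boundaryGraph D).Reachable ((k, 0), (k + 1, 0)) f := by
  obtain ⟨k, hk, hkmax⟩ := exists_max_mem_axis hfin h0
  set e₀ : PlanarEdge := ((k, 0), (k + 1, 0)) with he₀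
  have hb₀ : IsBoundaryEdge D e₀ := ⟨hk, hkmax _ (by omega), by simp [he₀, planarSteps]⟩
  obtain ⟨M, g, hg, hgM⟩ := exists_potential_contour hfin e₀
  have hboundary : ∀ e ∈ contour D e₀, IsBoundaryEdge D e := fun _ h => h.1
  have hg_horiz : ∀ j : ℤ, g (j, 0) - g (j + 1, 0) = flux (contour D e₀) (j, 0) (j + 1, 0) :=
    fun j => hg _ _ (by simp [planarSteps])
  have hg_right : g ((k : ℤ) + 1, 0) = 0 :=
    (eq_of_forall_eq_succ (f := fun j => g (j, 0)) (le_max_left _ M) fun j hj _ =>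
      sub_eq_zero.1 ((hg_horiz j).trans (flux_eq_zero hboundary
        (iff_of_false (hkmax j (by omega)) (hkmax _ (by omega)))))).trans
      (hgM _ ((le_max_right _ M).trans (le_abs_self _)))
  have hg_last : g ((k : ℤ), 0) = 1 := by
    have := (hg_horiz k).trans (flux_eq_one hboundary ⟨hb₀, SimpleGraph.Reachable.refl _⟩)
    rwa [hg_right, sub_zero] at this
  have hg_mem : ∀ u ∈ D, g 0 = g u := fun u hu => by
    have hpath := hconn u hu
    clear hu
    induction hpath with
    | refl => rfl
    | tail _ h ih =>
      exact ih.trans (sub_eq_zero.1 ((hg _ _ h.2.2).trans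
        (flux_eq_zero hboundary (iff_of_true h.1 h.2.1))))
  obtain ⟨j, hj, hflux⟩ : ∃ j : ℤ, j < 0 ∧ flux (contour D e₀) (j, 0) (j + 1, 0) ≠ 0 := by
    by_contra! hcon
    have hzero : g (min 0 (-M), 0) = g (0, 0) :=
      eq_of_forall_eq_succ (f := fun j => g (j, 0)) (min_le_left _ _) fun j _ hj =>
        sub_eq_zero.1 ((hg_horiz j).trans (hcon j hj))
    have hleft : g (min 0 (-M), 0) = 0 :=
      hgM _ ((le_neg.1 (min_le_right 0 (-M))).trans (neg_le_abs _))
    have hone : g (0, 0) = 1 := (hg_mem _ hk).trans hg_last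
    omega
  rcases mem_or_swap_mem_of_flux_ne_zero hflux with h | h
  · exact ⟨k, _, hb₀, hj.le, h.2⟩
  · exact ⟨k, _, hb₀, by simp only; omega, h.2⟩

/-- The lists of `n + 1` elements that start at `a` and in which every element is followed by one
of its neighbours, as given by `nbr`. -/
def chains {α : Type*} [DecidableEq α] (nbr : α → Finset α) : ℕ → α → Finset (List α)
  | 0, a => {[a]}
  | n + 1, a => (nbr a).biUnion fun b => (chains nbr n b).image (List.cons a)

theorem card_chains_le {α : Type*} [DecidableEq α] {nbr : α → Finset α} {c : ℕ}
    (hc : ∀ a, (nbr a).card ≤ c) (n : ℕ) (a : α) : (chains nbr n a).card ≤ c ^ n := by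
  induction n generalizing a with
  | zero => simp [chains]
  | succ n ih =>
    calc (chains nbr (n + 1) a).card ≤ (nbr a).card * c ^ n :=
          Finset.card_biUnion_le_card_mul _ _ _ fun b _ => Finset.card_image_le.trans (ih b)
      _ ≤ c ^ (n + 1) := by
          rw [pow_succ']
          exact Nat.mul_le_mul_right _ (hc a)

theorem cons_mem_chains {α : Type*} [DecidableEq α] {nbr : α → Finset α} {R : α → α → Prop}
    (hR : ∀ a b, R a b → b ∈ nbr a) {a : α} {l : List α} (h : List.IsChain R (a :: l)) :
    a :: l ∈ chains nbr l.length a := by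
  induction l generalizing a with
  | nil => simp [chains]
  | cons b l ih =>
    rw [List.isChain_cons_cons] at h
    exact Finset.mem_biUnion.2 ⟨b, hR a b h.1, Finset.mem_image_of_mem _ (ih h.2)⟩

/-- The oriented edges of the planar lattice whose first endpoint is within sup-distance one
of `b`. -/
def edgesNear (b : ℤ × ℤ) : Finset PlanarEdge :=
  (Finset.Icc (b - 1) (b + 1) ×ˢ planarSteps).image fun q => (q.1, q.1 + q.2)

theorem card_edgesNear_le (b : ℤ × ℤ) : (edgesNear b).card ≤ 36 := by
  refine Finset.card_image_le.trans ?_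
  rw [Finset.card_product, Finset.card_Icc_prod, Int.card_Icc, Int.card_Icc,
    show planarSteps.card = 4 from rfl]
  simp only [Prod.fst_add, Prod.fst_sub, Prod.snd_add, Prod.snd_sub, Prod.fst_one, Prod.snd_one]
  ring_nf
  rfl

theorem mem_edgesNear {b : ℤ × ℤ} {e : PlanarEdge} (h1 : |e.1.1 - b.1| ≤ 1)
    (h2 : |e.1.2 - b.2| ≤ 1) (h : e.2 - e.1 ∈ planarSteps) : e ∈ edgesNear b := by
  refine Finset.mem_image.2 ⟨(e.1, e.2 - e.1), ?_, by simp⟩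
  rw [abs_le] at h1 h2
  simp only [Finset.mem_product, Finset.mem_Icc, Prod.le_def, Prod.fst_add, Prod.fst_sub,
    Prod.snd_add, Prod.snd_sub, Prod.fst_one, Prod.snd_one]
  exact ⟨by omega, h⟩

theorem mem_edgesNear_of_adj {D : Set (ℤ × ℤ)} {e f : PlanarEdge}
    (h : (boundaryGraph D).Adj e f) : f ∈ edgesNear e.1 := by
  obtain ⟨-, -, hf, s, h1, -, h3, -⟩ := h
  simp only [InSquare] at h1 h3
  exact mem_edgesNear (by rw [abs_le]; omega) (by rw [abs_le]; omega) hf.2.2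

theorem sub_le_length_of_walk {D : Set (ℤ × ℤ)} {e f : PlanarEdge}
    (p : (boundaryGraph D).Walk e f) : e.1.1 - f.1.1 ≤ p.length := by
  induction p with
  | nil => simp
  | cons h p ih =>
    obtain ⟨s, h1, -, h3, -⟩ := h.2.2.2
    simp only [InSquare] at h1 h3
    rw [SimpleGraph.Walk.length_cons]
    push_cast
    omega

theorem isBoundaryEdge_of_reachable {D : Set (ℤ × ℤ)} {e f : PlanarEdge}
    (h : (boundaryGraph D).Reachable e f) (he : IsBoundaryEdge D e) : IsBoundaryEdge D f := by
  rw [SimpleGraph.reachable_iff_reflTransGen] at h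
  rcases h.cases_tail with rfl | ⟨_, _, hadj⟩
  · exact he
  · exact hadj.2.2.1

theorem exists_chain_boundaryEdge {D : Set (ℤ × ℤ)} (hfin : D.Finite) (h0 : 0 ∈ D)
    (hconn : IsStepConnected planarSteps D) :
    ∃ k : ℕ, ∃ l ∈ chains (fun e : PlanarEdge => edgesNear e.1) k ((k, 0), (k + 1, 0)),
      l.length = k + 1 ∧ l.Nodup ∧ ∀ e ∈ l, IsBoundaryEdge D e := by
  obtain ⟨k, f, hb, hf, hr⟩ := exists_reachable_boundaryEdge hfin h0 hconn
  obtain ⟨p, hp⟩ := hr.exists_isPath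
  have hk : k ≤ p.length := by
    have := sub_le_length_of_walk p
    simp only at this
    omega
  have hlen : (p.support.take (k + 1)).length = k + 1 := by
    rw [List.length_take, SimpleGraph.Walk.length_support]
    omega
  refine ⟨k, p.support.take (k + 1), ?_, hlen, hp.support_nodup.sublist (List.take_sublist _ _),
    fun e he => isBoundaryEdge_of_reachable (p.takeUntil e ?_).reachable hb⟩
  · have hc : List.IsChain (boundaryGraph D).Adj (p.support.take (k + 1)) :=
      p.isChain_adj_support.take _
    rw [← SimpleGraph.Walk.cons_tail_support, List.take_succ_cons] at hc hlen ⊢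
    have hmem := cons_mem_chains (R := (boundaryGraph D).Adj)
      (fun _ _ => mem_edgesNear_of_adj) hc
    rwa [Nat.succ_injective hlen] at hmem
  · exact List.mem_of_mem_take he

end Planar

section Exploration

variable {ι : Type*} {X : ι → Type*} {out : ∀ x, X x → Set ι} {o : ι}

/-- The set of sites that can be reached from `o` when the value `v x` at the site `x` gives access
to the sites of `out x (v x)`. -/
def cluster (out : ∀ x, X x → Set ι) (o : ι) (v : ∀ x, X x) : Set ι :=
  {y | Relation.ReflTransGen (fun x y => y ∈ out x (v x)) o y}

theorem mem_cluster_self (v : ∀ x, X x) : o ∈ cluster out o v := Relation.ReflTransGen.refl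

theorem mem_cluster_of_mem_out {v : ∀ x, X x} {x y : ι} (hx : x ∈ cluster out o v)
    (hy : y ∈ out x (v x)) : y ∈ cluster out o v := Relation.ReflTransGen.tail hx hy

theorem cluster_eq_of_eqOn {v w : ∀ x, X x} (h : ∀ x ∈ cluster out o v, v x = w x) :
    cluster out o w = cluster out o v := by
  refine Set.Subset.antisymm (fun y hy => ?_) fun y hy => ?_
  · induction hy with
    | refl => exact mem_cluster_self v
    | tail _ hxy ih => exact mem_cluster_of_mem_out ih (h _ ih ▸ hxy)
  · induction hy with
    | refl => exact mem_cluster_self w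
    | tail hx hxy ih => exact mem_cluster_of_mem_out ih (h _ hx ▸ hxy)

theorem dependsOn_cluster_eq (A : Set ι) :
    DependsOn (fun v => cluster out o v = A) A := by
  have himp : ∀ {v w : ∀ x, X x}, (∀ x ∈ A, v x = w x) → cluster out o v = A →
      cluster out o w = A := by
    rintro v w h rfl
    exact cluster_eq_of_eqOn h
  exact fun v w h => propext ⟨himp h, himp fun x hx => (h x hx).symm⟩

theorem preimage_image_restrict_of_dependsOn {A : Finset ι} {S : Set (∀ x, X x)}
    (hS : DependsOn (· ∈ S) (A : Set ι)) : A.restrict ⁻¹' (A.restrict '' S) = S := by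
  refine Set.Subset.antisymm ?_ (Set.subset_preimage_image _ _)
  rintro v ⟨w, hw, hwv⟩
  exact (hS fun x hx => congrFun hwv ⟨x, hx⟩).mp hw

section Measurable

variable [∀ x, MeasurableSpace (X x)] [∀ x, Countable (X x)]
  [∀ x, MeasurableSingletonClass (X x)]

theorem measurableSet_of_dependsOn {A : Finset ι} {S : Set (∀ x, X x)}
    (hS : DependsOn (· ∈ S) (A : Set ι)) : MeasurableSet S := by
  rw [← preimage_image_restrict_of_dependsOn hS]
  exact A.measurable_restrict (Set.to_countable _).measurableSet

theorem measurableSet_cluster_eq (A : Finset ι) :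
    MeasurableSet {v : ∀ x, X x | cluster out o v = A} :=
  measurableSet_of_dependsOn (dependsOn_cluster_eq _)

theorem measurableSet_infinite_cluster [Countable ι] :
    MeasurableSet {v : ∀ x, X x | (cluster out o v).Infinite} := by
  have h : {v : ∀ x, X x | (cluster out o v).Infinite} =
      (⋃ A : Finset ι, {v | cluster out o v = A})ᶜ := by
    ext v
    simp only [Set.mem_ofPred_eq, Set.mem_compl_iff, Set.mem_iUnion, not_exists]
    exact ⟨fun hv A hA => hv (hA ▸ A.finite_toSet),
      fun hv hfin => hv hfin.toFinset hfin.coe_toFinset.symm⟩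
  rw [h]
  exact (MeasurableSet.iUnion measurableSet_cluster_eq).compl

theorem infinitePi_inter_le {μ μ' : ∀ x, Measure (X x)} [∀ x, IsProbabilityMeasure (μ x)]
    [∀ x, IsProbabilityMeasure (μ' x)] {F : ∀ x, Set (X x)} {ρ : ι → ENNReal}
    (hμ : ∀ x, ∀ a ∈ F x, μ x {a} ≤ ρ x * μ' x {a}) {A : Finset ι} {S : Set (∀ x, X x)}
    (hS : DependsOn (· ∈ S) (A : Set ι)) :
    Measure.infinitePi μ {v | v ∈ S ∧ ∀ x ∈ A, v x ∈ F x} ≤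
      (∏ x ∈ A, ρ x) * Measure.infinitePi μ' S := by
  set T : Set (∀ x : A, X x) := A.restrict '' S
  have hinter : {v | v ∈ S ∧ ∀ x ∈ A, v x ∈ F x} =
      A.restrict ⁻¹' (T ∩ {v | ∀ x : A, v x ∈ F x}) := by
    rw [Set.preimage_inter, preimage_image_restrict_of_dependsOn hS]
    ext v
    simp [Finset.restrict]
  have hmeas : ∀ U : Set (∀ x : A, X x), MeasurableSet U := fun U =>
    (Set.to_countable U).measurableSet
  rw [hinter, ← Measure.map_apply A.measurable_restrict (hmeas _),
    Measure.infinitePi_map_restrict, ← preimage_image_restrict_of_dependsOn hS,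
    ← Measure.map_apply A.measurable_restrict (hmeas _), Measure.infinitePi_map_restrict,
    ← Measure.tsum_indicator_apply_singleton _ _ (hmeas _),
    ← Measure.tsum_indicator_apply_singleton _ _ (hmeas _), ← ENNReal.tsum_mul_left]
  refine ENNReal.tsum_le_tsum fun v => ?_
  by_cases hv : v ∈ T ∩ {v | ∀ x : A, v x ∈ F x}
  · rw [Set.indicator_of_mem hv, Set.indicator_of_mem hv.1, Measure.pi_singleton,
      Measure.pi_singleton, ← Finset.prod_coe_sort A, ← Finset.prod_mul_distrib]
    exact Finset.prod_le_prod' fun x _ => hμ x _ (hv.2 x)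
  · rw [Set.indicator_of_notMem hv]
    exact zero_le

end Measurable

theorem exists_isProbabilityMeasure_le_mul {α : Type*} [MeasurableSpace α]
    [MeasurableSingletonClass α] (μ : Measure α) [IsProbabilityMeasure μ] {F : Set α}
    (hF : MeasurableSet F) {ρ : ENNReal} (hρ : μ F ≤ ρ) :
    ∃ μ' : Measure α, IsProbabilityMeasure μ' ∧ ∀ a ∈ F, μ {a} ≤ ρ * μ' {a} := by
  by_cases h : μ F = 0
  · refine ⟨μ, inferInstance, fun a ha => ?_⟩
    rw [measure_mono_null (Set.singleton_subset_iff.2 ha) h]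
    exact zero_le
  · refine ⟨μ[|F], cond_isProbabilityMeasure h, fun a ha => ?_⟩
    calc μ {a} = μ[|F] {a} * μ F := by
          rw [cond_mul_eq_inter hF,
            Set.inter_eq_self_of_subset_right (Set.singleton_subset_iff.2 ha)]
      _ ≤ ρ * μ[|F] {a} := by
          rw [mul_comm]
          gcongr

/-- The constraint `F` is tested only at the sites that the exploration of the cluster visits, so
that conditioning each site on `F` costs a factor `ρ` per site of the cluster. -/
theorem infinitePi_cluster_le [Countable ι] [∀ x, MeasurableSpace (X x)] [∀ x, Countable (X x)]
    [∀ x, MeasurableSingletonClass (X x)] (μ : ∀ x, Measure (X x))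
    [∀ x, IsProbabilityMeasure (μ x)] {F : ∀ x, Set (X x)} {ρ : ι → ENNReal}
    (hρ : ∀ x, μ x (F x) ≤ ρ x) (r : ENNReal) :
    Measure.infinitePi μ {v | ∃ A : Finset ι, cluster out o v = A ∧
      (∀ x ∈ A, v x ∈ F x) ∧ ∏ x ∈ A, ρ x ≤ r} ≤ r := by
  choose μ' _ hμ' using fun x =>
    exists_isProbabilityMeasure_le_mul (μ x) (Set.to_countable (F x)).measurableSet (hρ x)
  let S : Finset ι → Set (∀ x, X x) := fun A => {v | cluster out o v = A}
  have hdisj : Pairwise (Function.onFun Disjoint S) := fun A B hAB =>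
    Set.disjoint_left.2 fun v (hA : _ = _) (hB : _ = _) =>
      hAB (Finset.coe_injective (hA.symm.trans hB))
  calc Measure.infinitePi μ {v | ∃ A : Finset ι, cluster out o v = A ∧
        (∀ x ∈ A, v x ∈ F x) ∧ ∏ x ∈ A, ρ x ≤ r}
      ≤ Measure.infinitePi μ (⋃ A : Finset ι, {v | ∏ x ∈ A, ρ x ≤ r ∧
          v ∈ S A ∧ ∀ x ∈ A, v x ∈ F x}) :=
        measure_mono fun v ⟨A, hA, hF, hr⟩ => Set.mem_iUnion.2 ⟨A, hr, hA, hF⟩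
    _ ≤ ∑' A : Finset ι, Measure.infinitePi μ {v | ∏ x ∈ A, ρ x ≤ r ∧
          v ∈ S A ∧ ∀ x ∈ A, v x ∈ F x} := measure_iUnion_le _
    _ ≤ ∑' A : Finset ι, r * Measure.infinitePi μ' (S A) := by
        refine ENNReal.tsum_le_tsum fun A => ?_
        by_cases hA : ∏ x ∈ A, ρ x ≤ r
        · simp only [hA, true_and]
          exact (infinitePi_inter_le (S := S A) hμ' (dependsOn_cluster_eq _)).trans
            (mul_le_mul' hA le_rfl)
        · simp [hA]
    _ = r * Measure.infinitePi μ' (⋃ A, S A) := by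
        rw [ENNReal.tsum_mul_left, measure_iUnion hdisj measurableSet_cluster_eq]
    _ ≤ r := mul_le_of_le_one_right' prob_le_one

end Exploration

section RandomWalk

variable {d N : ℕ}

/-- The unit vector of `ℤ^d` with the given axis and sign. -/
def unitStep (q : Fin d × Bool) : Site d := Pi.single q.1 (if q.2 then 1 else -1)

theorem unitStep_apply (q : Fin d × Bool) (j : Fin d) :
    unitStep q j = if j = q.1 then (if q.2 then 1 else -1) else 0 := by
  simp [unitStep, Pi.single_apply]

theorem unitStep_injective : Function.Injective (unitStep (d := d)) := by
  rintro ⟨i, a⟩ ⟨j, b⟩ h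
  have hi := congrFun h i
  simp only [unitStep_apply] at hi
  by_cases hij : i = j
  · subst hij
    cases a <;> cases b <;> simp_all
  · cases a <;> simp_all

theorem unitStep_mem (q : Fin d × Bool) : unitStep q ∈ unitSteps d := by
  obtain ⟨i, a⟩ := q
  change ∑ j, |unitStep (i, a) j| = 1
  rw [Finset.sum_eq_single i (fun j _ hj => by simp [unitStep_apply, hj]) (by simp)]
  cases a <;> simp [unitStep_apply]

theorem exists_eq_unitStep {e : Site d} (he : e ∈ unitSteps d) : ∃ q, e = unitStep q := by
  replace he : ∑ j, |e j| = 1 := he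
  obtain ⟨i, -, hi⟩ : ∃ i ∈ Finset.univ, |e i| ≠ 0 :=
    Finset.exists_ne_zero_of_sum_ne_zero (by rw [he]; exact one_ne_zero)
  have hsplit := Finset.add_sum_erase Finset.univ (fun j => |e j|) (Finset.mem_univ i)
  have hnonneg : 0 ≤ ∑ j ∈ Finset.univ.erase i, |e j| := Finset.sum_nonneg fun j _ => abs_nonneg _
  have hpos := (abs_nonneg (e i)).lt_of_ne' hi
  have hother : ∀ j, j ≠ i → e j = 0 := fun j hj =>
    abs_eq_zero.1 ((Finset.sum_eq_zero_iff_of_nonneg fun j _ => abs_nonneg _).1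
      (by omega : ∑ j ∈ Finset.univ.erase i, |e j| = 0) j (by simpa using hj))
  refine ⟨(i, decide (e i = 1)), funext fun j => ?_⟩
  rcases eq_or_ne j i with rfl | hj
  · rcases (abs_eq zero_le_one).1 (by omega : |e j| = 1) with h | h <;> simp [unitStep_apply, h]
  · simp [unitStep_apply, hj, hother j hj]

theorem stepLaw_singleton_unitStep (q : Fin d × Bool) :
    stepLaw d {unitStep q} = (2 * d : ENNReal)⁻¹ := by
  have hrange : unitSteps d = (Finset.univ.image unitStep : Finset (Site d)) := by
    ext e
    simp only [Finset.coe_image, Finset.coe_univ, Set.image_univ, Set.mem_range]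
    exact ⟨fun he => (exists_eq_unitStep he).imp fun _ => Eq.symm,
      fun ⟨q, hq⟩ => hq ▸ unitStep_mem q⟩
  rw [stepLaw, hrange, ← Finset.coe_singleton, uniformOn_apply_finset,
    Finset.inter_singleton_of_mem (Finset.mem_image_of_mem _ (Finset.mem_univ q)),
    Finset.card_image_of_injective _ unitStep_injective]
  simp [mul_comm]

theorem stepLaw_unitSteps (hd : 0 < d) : stepLaw d (unitSteps d) = 1 :=
  uniformOn_self (finite_unitSteps d) (nonempty_unitSteps hd)

/-- The law of `N` steps of simple random walk. -/
def stepsLaw (d N : ℕ) : Measure (Fin N → Site d) := Measure.pi fun _ => stepLaw d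

theorem isProbabilityMeasure_stepsLaw (hd : 0 < d) (N : ℕ) :
    IsProbabilityMeasure (stepsLaw d N) := by
  have := isProbabilityMeasure_stepLaw hd
  unfold stepsLaw
  infer_instance

/-- The sequences of `N` unit steps along which the walk from `x` visits `B`. -/
def hitSet (B : Set (Site d)) (N : ℕ) (x : Site d) : Set (Fin N → Site d) :=
  {s | (∀ k, s k ∈ unitSteps d) ∧ ∃ n, x + Fin.partialSum s n ∈ B}

/-- The mean of `w` over the neighbours of `x`. -/
def neighborAverage (w : Site d → ℝ) (x : Site d) : ℝ :=
  (2 * d : ℝ)⁻¹ * ∑ q, w (x + unitStep q)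

theorem neighborAverage_mono {w w' : Site d → ℝ} (h : ∀ x, w x ≤ w' x) (x : Site d) :
    neighborAverage w x ≤ neighborAverage w' x :=
  mul_le_mul_of_nonneg_left (Finset.sum_le_sum fun q _ => h _) (by positivity)

theorem neighborAverage_sub_const (hd : 0 < d) (w : Site d → ℝ) (a : ℝ) (x : Site d) :
    neighborAverage (fun y => w y - a) x = neighborAverage w x - a := by
  have hd' : (d : ℝ) ≠ 0 := by positivity
  simp only [neighborAverage, Finset.sum_sub_distrib, Finset.sum_const, Finset.card_univ,
    Fintype.card_prod, Fintype.card_fin, Fintype.card_bool, nsmul_eq_mul, Nat.cast_mul,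
    Nat.cast_ofNat]
  field_simp

theorem stepsLaw_hitSet_of_mem (hd : 0 < d) {B : Set (Site d)} (N : ℕ) {x : Site d}
    (hx : x ∈ B) : (stepsLaw d N).real (hitSet B N x) = 1 := by
  have := isProbabilityMeasure_stepLaw hd
  have h : hitSet B N x = Set.univ.pi fun _ => unitSteps d := by
    ext s
    simp only [hitSet, Set.mem_ofPred_eq, Set.mem_univ_pi, and_iff_left_iff_imp]
    exact fun _ => ⟨0, by simpa using hx⟩
  rw [h, stepsLaw, Measure.real, Measure.pi_pi]
  simp [stepLaw_unitSteps hd]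

theorem stepsLaw_real_firstStep (hd : 0 < d) (q : Fin d × Bool) (S : Set (Fin N → Site d)) :
    (stepsLaw d (N + 1)).real {s | s 0 = unitStep q ∧ Fin.tail s ∈ S} =
      (2 * d : ℝ)⁻¹ * (stepsLaw d N).real S := by
  have := isProbabilityMeasure_stepLaw hd
  have h := (measurePreserving_piFinSuccAbove (fun _ : Fin (N + 1) => stepLaw d)
    0).measure_preimage (s := {unitStep q} ×ˢ S)
    (Set.to_countable _).measurableSet.nullMeasurableSet
  rw [Measure.prod_prod, stepLaw_singleton_unitStep] at h
  have htoReal := congrArg ENNReal.toReal h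
  rw [ENNReal.toReal_mul, ENNReal.toReal_inv, ENNReal.toReal_mul, ENNReal.toReal_ofNat,
    ENNReal.toReal_natCast] at htoReal
  exact htoReal

theorem neighborAverage_stepsLaw_hitSet_le (hd : 0 < d) (B : Set (Site d)) (N : ℕ) (x : Site d) :
    neighborAverage (fun y => (stepsLaw d N).real (hitSet B N y)) x ≤
      (stepsLaw d (N + 1)).real (hitSet B (N + 1) x) := by
  have := isProbabilityMeasure_stepsLaw hd (N + 1)
  let T : Fin d × Bool → Set (Fin (N + 1) → Site d) := fun q =>
    {s | s 0 = unitStep q ∧ Fin.tail s ∈ hitSet B N (x + unitStep q)}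
  have hdisj : Pairwise (Function.onFun Disjoint T) := fun p q hpq =>
    Set.disjoint_left.2 fun s hp hq => hpq (unitStep_injective (hp.1.symm.trans hq.1))
  rw [neighborAverage, Finset.mul_sum,
    ← Finset.sum_congr rfl fun q _ => stepsLaw_real_firstStep hd q _,
    ← measureReal_biUnion_finset (hdisj.set_pairwise _)
      fun q _ => (Set.to_countable (T q)).measurableSet]
  refine measureReal_mono (Set.iUnion₂_subset fun q _ s ⟨h0, htail, n, hn⟩ => ?_)
  refine ⟨Fin.cases (h0 ▸ unitStep_mem q) htail, n.succ, ?_⟩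
  rwa [Fin.partialSum_succ', h0, ← add_assoc]

theorem sub_max_le_stepsLaw_hitSet (hd : 0 < d) {B : Set (Site d)} {w : Site d → ℝ} {ε : ℝ}
    (hε : 0 ≤ ε) (hw : ∀ x, w x ≤ 1) (hsub : ∀ x ∉ B, w x ≤ 0 ∨ w x + ε ≤ neighborAverage w x)
    (N : ℕ) (x : Site d) :
    w x - max 0 (1 - N * ε) ≤ (stepsLaw d N).real (hitSet B N x) := by
  induction N generalizing x with
  | zero =>
    rw [Nat.cast_zero, zero_mul, sub_zero, max_eq_right zero_le_one]
    exact (sub_nonpos.2 (hw x)).trans measureReal_nonneg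
  | succ N ih =>
    have hmax : 0 ≤ max 0 (1 - ((N + 1 : ℕ) : ℝ) * ε) := le_max_left _ _
    by_cases hx : x ∈ B
    · rw [stepsLaw_hitSet_of_mem hd _ hx]
      linarith [hw x]
    rcases hsub x hx with h | h
    · exact (by linarith : _ ≤ (0 : ℝ)).trans measureReal_nonneg
    have hstep : max 0 (1 - N * ε) ≤ max 0 (1 - ((N + 1 : ℕ) : ℝ) * ε) + ε := by
      refine max_le (by linarith) ?_
      have := le_max_right 0 (1 - ((N + 1 : ℕ) : ℝ) * ε)
      push_cast at this ⊢
      linarith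
    calc w x - max 0 (1 - ((N + 1 : ℕ) : ℝ) * ε)
        ≤ neighborAverage w x - max 0 (1 - N * ε) := by linarith
      _ = neighborAverage (fun y => w y - max 0 (1 - N * ε)) x :=
          (neighborAverage_sub_const hd w _ x).symm
      _ ≤ neighborAverage (fun y => (stepsLaw d N).real (hitSet B N y)) x :=
          neighborAverage_mono ih x
      _ ≤ _ := neighborAverage_stepsLaw_hitSet_le hd B N x

theorem one_add_sq_div_two_le_cosh (t : ℝ) : 1 + t ^ 2 / 2 ≤ Real.cosh t := by
  have h := sum_le_hasSum (Finset.range 2)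
    (fun n _ => div_nonneg (pow_mul t 2 n ▸ by positivity) (by positivity)) (Real.hasSum_cosh t)
  simpa [Finset.sum_range_succ] using h

theorem two_add_le_exp_neg_mul_cosh_add_cosh {s a b : ℝ} (hs : 0 ≤ s) (hs' : s ≤ 1 / 2)
    (hab : 3 ≤ s * (a ^ 2 + b ^ 2)) :
    2 + s ≤ Real.exp (-s) * (Real.cosh (2 * s * a) + Real.cosh (2 * s * b)) := by
  have ha := one_add_sq_div_two_le_cosh (2 * s * a)
  have hb := one_add_sq_div_two_le_cosh (2 * s * b)
  have hexp : 1 - s ≤ Real.exp (-s) := by linarith [Real.add_one_le_exp (-s)]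
  have hcosh : 2 + 6 * s ≤ Real.cosh (2 * s * a) + Real.cosh (2 * s * b) := by nlinarith
  calc 2 + s ≤ (1 - s) * (2 + 6 * s) := by nlinarith
    _ ≤ _ := mul_le_mul hexp hcosh (by linarith) (Real.exp_pos _).le

theorem exp_neg_mul_sq_add_one_add_sub_one (s a q : ℝ) :
    Real.exp (-(s * ((a + 1) ^ 2 + q))) + Real.exp (-(s * ((a - 1) ^ 2 + q))) =
      Real.exp (-(s * (a ^ 2 + q))) * (2 * (Real.exp (-s) * Real.cosh (2 * s * a))) := by
  have hsub : Real.exp (-(s * ((a + 1) ^ 2 + q))) =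
      Real.exp (-(s * (a ^ 2 + q))) * Real.exp (-s) * Real.exp (-(2 * s * a)) := by
    rw [← Real.exp_add, ← Real.exp_add]
    ring_nf
  have hadd : Real.exp (-(s * ((a - 1) ^ 2 + q))) =
      Real.exp (-(s * (a ^ 2 + q))) * Real.exp (-s) * Real.exp (2 * s * a) := by
    rw [← Real.exp_add, ← Real.exp_add]
    ring_nf
  rw [hsub, hadd, Real.cosh_eq]
  ring

/-- The squared distance from `c` of the projection of `x` to the plane of the axes `i₀` and
`i₁`. -/
def planarDistSq (i₀ i₁ : Fin d) (c : ℤ × ℤ) (x : Site d) : ℤ :=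
  (x i₀ - c.1) ^ 2 + (x i₁ - c.2) ^ 2

theorem neighborAverage_eq_add_sum (hd : 0 < d) (w : Site d → ℝ) (x : Site d) :
    neighborAverage w x = w x + (2 * d : ℝ)⁻¹ *
      ∑ i, (w (x + unitStep (i, true)) + w (x + unitStep (i, false)) - 2 * w x) := by
  have hd' : (d : ℝ) ≠ 0 := by positivity
  rw [neighborAverage, Fintype.sum_prod_type]
  simp only [Fintype.sum_bool, Finset.sum_sub_distrib, Finset.sum_const, Finset.card_univ,
    Fintype.card_fin, nsmul_eq_mul]
  field_simp
  ring

theorem mul_exp_le_neighborAverage {i₀ i₁ : Fin d} (hi : i₀ ≠ i₁) {s : ℝ} (hs : 0 ≤ s)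
    (hs' : s ≤ 1 / 2) {c : ℤ × ℤ} {x : Site d} (hx : 3 ≤ s * planarDistSq i₀ i₁ c x) :
    (1 + s / d) * Real.exp (-(s * planarDistSq i₀ i₁ c x)) ≤
      neighborAverage (fun y => Real.exp (-(s * planarDistSq i₀ i₁ c y))) x := by
  set W : Site d → ℝ := fun y => Real.exp (-(s * planarDistSq i₀ i₁ c y)) with hW
  set a : ℝ := x i₀ - c.1 with ha
  set b : ℝ := x i₁ - c.2 with hb
  have hd : (0 : ℝ) < d := by exact_mod_cast i₀.pos
  have hdist : (planarDistSq i₀ i₁ c x : ℝ) = a ^ 2 + b ^ 2 := by simp [planarDistSq, ha, hb]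
  have h₀ : W (x + unitStep (i₀, true)) + W (x + unitStep (i₀, false)) =
      W x * (2 * (Real.exp (-s) * Real.cosh (2 * s * a))) := by
    simp only [hW, hdist]
    rw [← exp_neg_mul_sq_add_one_add_sub_one]
    simp only [planarDistSq, Pi.add_apply, unitStep_apply, if_neg hi.symm, if_true, ha, hb,
      Bool.false_eq_true, if_false, add_zero]
    push_cast
    ring_nf
  have h₁ : W (x + unitStep (i₁, true)) + W (x + unitStep (i₁, false)) =
      W x * (2 * (Real.exp (-s) * Real.cosh (2 * s * b))) := by
    simp only [hW, hdist, add_comm (a ^ 2)]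
    rw [← exp_neg_mul_sq_add_one_add_sub_one]
    simp only [planarDistSq, Pi.add_apply, unitStep_apply, if_neg hi, if_true, ha, hb,
      Bool.false_eq_true, if_false, add_zero]
    push_cast
    ring_nf
  have hother : ∀ i, i ≠ i₀ ∧ i ≠ i₁ →
      W (x + unitStep (i, true)) + W (x + unitStep (i, false)) - 2 * W x = 0 := fun i hne => by
    simp only [hW, planarDistSq, Pi.add_apply, unitStep_apply, if_neg hne.1.symm,
      if_neg hne.2.symm, add_zero]
    ring
  rw [neighborAverage_eq_add_sum i₀.pos, Finset.sum_eq_add i₀ i₁ hi (fun i _ => hother i)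
    (by simp) (by simp), h₀, h₁]
  have hcosh := two_add_le_exp_neg_mul_cosh_add_cosh hs hs' (a := a) (b := b) (hdist ▸ hx)
  calc (1 + s / d) * W x = W x + (2 * d : ℝ)⁻¹ * (W x * (2 * (2 + s)) - 4 * W x) := by
        field_simp
        ring
    _ ≤ W x + (2 * d : ℝ)⁻¹ * (W x * (2 * (Real.exp (-s) *
          (Real.cosh (2 * s * a) + Real.cosh (2 * s * b)))) - 4 * W x) := by
        have : 0 ≤ W x := (Real.exp_pos _).le
        gcongr
    _ = _ := by ring

/-- The bound depends on the scale `s` only through the assumptions: this makes the hitting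
probabilities of large discs uniform in their radius. -/
theorem exists_exp_sub_exp_le_stepsLaw_hitSet {i₀ i₁ : Fin d} (hi : i₀ ≠ i₁) {s : ℝ} (hs : 0 < s)
    (hs' : s ≤ 1 / 2) (a b : ℝ) :
    ∃ N₀ : ℕ, ∀ N ≥ N₀, ∀ (c : ℤ × ℤ) (B : Set (Site d)),
      (∀ x, s * planarDistSq i₀ i₁ c x < 3 → x ∈ B) → ∀ x, s * planarDistSq i₀ i₁ c x ≤ a →
        Real.exp (-a) - Real.exp (-b) ≤ (stepsLaw d N).real (hitSet B N x) := by
  have hd : (0 : ℝ) < d := by exact_mod_cast i₀.pos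
  set ε : ℝ := s / d * Real.exp (-b)
  have hεpos : 0 < ε := by positivity
  obtain ⟨N₀, hN₀⟩ := exists_nat_ge (1 / ε)
  refine ⟨N₀, fun N hN c B hB x hx => ?_⟩
  set W : Site d → ℝ := fun y => Real.exp (-(s * planarDistSq i₀ i₁ c y))
  have hle : ∀ y, W y - Real.exp (-b) ≤ 1 := fun y => by
    have hy : 0 ≤ s * (planarDistSq i₀ i₁ c y : ℝ) :=
      mul_nonneg hs.le (by exact_mod_cast add_nonneg (sq_nonneg _) (sq_nonneg _))
    linarith [Real.exp_pos (-b), Real.exp_le_one_iff.2 (neg_nonpos.2 hy)]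
  have hsub : ∀ y ∉ B, W y - Real.exp (-b) ≤ 0 ∨
      W y - Real.exp (-b) + ε ≤ neighborAverage (fun z => W z - Real.exp (-b)) y := by
    intro y hy
    refine (le_total (W y) (Real.exp (-b))).imp sub_nonpos.2 fun hb => ?_
    have hgauss : (1 + s / d) * W y ≤ neighborAverage W y :=
      mul_exp_le_neighborAverage hi hs.le hs' (not_lt.1 (mt (hB y) hy))
    have hεW : ε ≤ s / d * W y := mul_le_mul_of_nonneg_left hb (by positivity)
    rw [neighborAverage_sub_const i₀.pos]
    linarith
  have hNε : 1 - (N : ℝ) * ε ≤ 0 :=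
    sub_nonpos.2 ((div_le_iff₀ hεpos).1 (hN₀.trans (by exact_mod_cast hN)))
  calc Real.exp (-a) - Real.exp (-b) ≤ W x - Real.exp (-b) - max 0 (1 - N * ε) := by
        rw [max_eq_left hNε, sub_zero]
        exact sub_le_sub_right (Real.exp_le_exp.2 (neg_le_neg hx)) _
    _ ≤ _ := sub_max_le_stepsLaw_hitSet i₀.pos hεpos.le hle hsub N x

end RandomWalk

section FirstParticles

variable {ι X Y : Type*} [MeasurableSpace X] [MeasurableSpace Y]

theorem measurePreserving_prodMk_infinitePi (μ : ι → Measure X) (ν : ι → Measure Y)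
    [∀ i, IsProbabilityMeasure (μ i)] [∀ i, IsProbabilityMeasure (ν i)] :
    MeasurePreserving (fun (ω : (ι → X) × (ι → Y)) i => (ω.1 i, ω.2 i))
      ((Measure.infinitePi μ).prod (Measure.infinitePi ν))
      (Measure.infinitePi fun i => (μ i).prod (ν i)) := by
  refine ⟨by fun_prop, IsProjectiveLimit.unique (fun I => ?_)
    (Measure.isProjectiveLimit_infinitePi _)⟩
  have hrestrict := (MeasurePreserving.mk (Finset.measurable_restrict I)
    (Measure.infinitePi_map_restrict (μ := μ))).prod
    ⟨Finset.measurable_restrict I, Measure.infinitePi_map_restrict (μ := ν)⟩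
  have hzip := (measurePreserving_arrowProdEquivProdArrow X Y I (fun i => μ i) fun i => ν i).symm
  rw [Measure.map_map (Finset.measurable_restrict I) (by fun_prop)]
  exact (hzip.comp hrestrict).map_eq

variable {d N : ℕ}

/-- What is kept of a site when only its first particle is used, and only for `N` steps: the
initial number of particles, the steps and the lifetime of the first particle. -/
abbrev Frog (d N : ℕ) : Type := ℕ × (Fin N → Site d) × ℕ∞

/-- The reduced configuration: every site with its first particle only. -/
def frogs (N : ℕ) (ω : Config d) (x : Site d) : Frog d N :=
  (count ω x, fun k => ω.2.1 (x, 0, k), lifetime ω x 0)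

/-- The law of the reduced configuration at one site. -/
def frogLaw (d N : ℕ) (ν : Measure ℕ) (p : unitInterval) : Measure (Frog d N) :=
  ν.prod ((stepsLaw d N).prod (lifetimeLaw p))

theorem isProbabilityMeasure_frogLaw (hd : 0 < d) (N : ℕ) (ν : Measure ℕ)
    [IsProbabilityMeasure ν] (p : unitInterval) : IsProbabilityMeasure (frogLaw d N ν p) := by
  have := isProbabilityMeasure_stepsLaw hd N
  unfold frogLaw
  infer_instance

theorem measurePreserving_firstSteps (hd : 0 < d) (N : ℕ) :
    MeasurePreserving (fun (s : Site d × ℕ × ℕ → Site d) x (k : Fin N) => s (x, 0, k))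
      (Measure.infinitePi fun _ => stepLaw d) (Measure.infinitePi fun _ => stepsLaw d N) := by
  have := isProbabilityMeasure_stepLaw hd
  have hinj : Function.Injective fun q : Site d × Fin N => (q.1, 0, (q.2 : ℕ)) := by
    rintro ⟨x, j⟩ ⟨y, k⟩ h
    simpa [Fin.ext_iff] using h
  have hselect := MeasurePreserving.mk (by fun_prop)
    (Measure.map_infinitePi_infinitePi_of_inj (P := fun _ => stepLaw d) hinj)
  have hcurry := MeasurePreserving.mk (MeasurableEquiv.measurable _)
    (Measure.infinitePi_map_curry fun (_ : Site d) (_ : Fin N) => stepLaw d)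
  simp only [Measure.infinitePi_eq_pi] at hcurry
  exact hcurry.comp hselect

theorem measurePreserving_frogs (hd : 0 < d) (N : ℕ) (ν : Measure ℕ) [IsProbabilityMeasure ν]
    (p : unitInterval) :
    MeasurePreserving (frogs N) (law d ν p) (Measure.infinitePi fun _ => frogLaw d N ν p) := by
  have := isProbabilityMeasure_stepLaw hd
  have := isProbabilityMeasure_stepsLaw hd N
  have hlifetime := MeasurePreserving.mk (by fun_prop)
    (Measure.map_infinitePi_infinitePi_of_inj (P := fun _ => lifetimeLaw p)
      (Prod.mk_left_injective (α := Site d) (0 : ℕ)))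
  exact (measurePreserving_prodMk_infinitePi _ _).comp <| (MeasurePreserving.id _).prod <|
    (measurePreserving_prodMk_infinitePi _ _).comp <|
      (measurePreserving_firstSteps hd N).prod hlifetime

theorem lifetimeLaw_Iic_le (p : unitInterval) (N : ℕ) :
    lifetimeLaw p (Set.Iic (N : ℕ∞)) ≤ ENNReal.ofReal (N * (1 - p)) := by
  have hp : 0 ≤ 1 - (p : ℝ) := sub_nonneg.2 p.2.2
  unfold lifetimeLaw
  split_ifs with h
  · have hlate : ∀ k ∉ Finset.range N, (ENNReal.ofReal ((1 - (p : ℝ)) * (p : ℝ) ^ k) •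
        Measure.dirac ((k + 1 : ℕ) : ℕ∞)) (Set.Iic (N : ℕ∞)) = 0 := fun k hk => by
      rw [Finset.mem_range, not_lt] at hk
      have hnotMem : ((k + 1 : ℕ) : ℕ∞) ∉ Set.Iic (N : ℕ∞) :=
        fun h => (Nat.lt_succ_of_le hk).not_ge (by exact_mod_cast Set.mem_Iic.1 h)
      rw [Measure.smul_apply, Measure.dirac_apply, Set.indicator_of_notMem hnotMem, smul_zero]
    rw [Measure.sum_apply _ MeasurableSet.of_discrete, tsum_eq_sum hlate]
    calc _ ≤ ∑ k ∈ Finset.range N, ENNReal.ofReal (1 - (p : ℝ)) := by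
          refine Finset.sum_le_sum fun k _ => (mul_le_of_le_one_right' prob_le_one).trans ?_
          exact ENNReal.ofReal_le_ofReal
            (mul_le_of_le_one_right hp (pow_le_one₀ p.2.1 p.2.2))
      _ = _ := by
          rw [Finset.sum_const, Finset.card_range, nsmul_eq_mul,
            ENNReal.ofReal_mul (Nat.cast_nonneg N), ENNReal.ofReal_natCast]
  · simp

theorem two_inv_le_lifetimeLaw_Ioi {p : unitInterval} (h : N * (1 - (p : ℝ)) ≤ 1 / 2) :
    2⁻¹ ≤ lifetimeLaw p (Set.Ioi (N : ℕ∞)) := by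
  have hIic : lifetimeLaw p (Set.Iic (N : ℕ∞)) ≤ 2⁻¹ := by
    refine (lifetimeLaw_Iic_le p N).trans ((ENNReal.ofReal_le_ofReal h).trans_eq ?_)
    rw [one_div, ENNReal.ofReal_inv_of_pos two_pos, ENNReal.ofReal_ofNat]
  rw [← Set.compl_Iic, prob_compl_eq_one_sub MeasurableSet.of_discrete,
    ← ENNReal.one_sub_inv_two]
  exact tsub_le_tsub_left hIic 1

theorem mul_le_frogLaw_prod (hd : 0 < d) {ν : Measure ℕ} [IsProbabilityMeasure ν]
    {p : unitInterval} (h : N * (1 - (p : ℝ)) ≤ 1 / 2) (S : Set (Fin N → Site d)) :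
    ν {n | 1 ≤ n} * (stepsLaw d N S * 2⁻¹) ≤
      frogLaw d N ν p ({n | 1 ≤ n} ×ˢ S ×ˢ Set.Ioi (N : ℕ∞)) := by
  have := isProbabilityMeasure_stepsLaw hd N
  rw [frogLaw, Measure.prod_prod, Measure.prod_prod]
  gcongr
  exact two_inv_le_lifetimeLaw_Ioi h

end FirstParticles

section Activation

variable {d N : ℕ} {ω : Config d} {x y : Site d}

theorem hitTime_le {i n : ℕ} (hi : i < count ω x) (hn : (n : ℕ∞) < lifetime ω x i)
    (h : walk ω x i n = y) : hitTime ω x y ≤ n :=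
  iInf₂_le_of_le i n (iInf_le _ ⟨hi, hn, h⟩)

theorem exists_hitTime_eq (h : hitTime ω x y ≠ ⊤) :
    ∃ i < count ω x, ∃ n : ℕ, walk ω x i n = y ∧ hitTime ω x y = n := by
  have hlt : hitTime ω x y < hitTime ω x y + 1 := (ENat.lt_add_one_iff h).2 le_rfl
  conv_lhs at hlt => rw [hitTime]
  simp only [iInf_lt_iff] at hlt
  obtain ⟨i, n, ⟨hi, hn, hw⟩, hle⟩ := hlt
  exact ⟨i, hi, n, hw, (hitTime_le hi hn hw).antisymm ((ENat.lt_add_one_iff h).1 hle)⟩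

theorem eq_of_hitTime_eq_zero (h : hitTime ω x y = 0) : x = y := by
  obtain ⟨i, -, n, hw, hn⟩ := exists_hitTime_eq (h.trans_ne ENat.zero_ne_top)
  obtain rfl : n = 0 := by exact_mod_cast hn.symm.trans h
  simpa [walk] using hw

theorem finite_hitTime_le (ω : Config d) (x : Site d) (n : ℕ) : {y | hitTime ω x y ≤ n}.Finite := by
  refine ((Finset.range (count ω x) ×ˢ Finset.range (n + 1)).finite_toSet.image
    fun q => walk ω x q.1 q.2).subset fun y hy => ?_
  obtain ⟨i, hi, k, hw, hk⟩ := exists_hitTime_eq (ne_top_of_le_ne_top (ENat.natCast_ne_top n) hy)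
  have hkn : k ≤ n := by exact_mod_cast hk.symm.trans_le hy
  exact ⟨(i, k), by simp [hi, Nat.lt_succ_of_le hkn], hw⟩

theorem activationTime_le_sum {m : ℕ} {z : Fin (m + 1) → Site d} (h0 : z 0 = 0) :
    activationTime ω (z (Fin.last m)) ≤ ∑ j : Fin m, hitTime ω (z j.castSucc) (z j.succ) :=
  iInf₂_le_of_le m z (iInf_le _ ⟨h0, rfl⟩)

theorem exists_activationTime_eq_sum (h : activationTime ω x ≠ ⊤) :
    ∃ (m : ℕ) (z : Fin (m + 1) → Site d), z 0 = 0 ∧ z (Fin.last m) = x ∧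
      activationTime ω x = ∑ j : Fin m, hitTime ω (z j.castSucc) (z j.succ) := by
  have hlt : activationTime ω x < activationTime ω x + 1 := (ENat.lt_add_one_iff h).2 le_rfl
  conv_lhs at hlt => rw [activationTime]
  simp only [iInf_lt_iff] at hlt
  obtain ⟨m, z, ⟨h0, rfl⟩, hle⟩ := hlt
  exact ⟨m, z, h0, rfl, (activationTime_le_sum h0).antisymm ((ENat.lt_add_one_iff h).1 hle)⟩

theorem activationTime_zero (ω : Config d) : activationTime ω 0 = 0 :=
  le_antisymm (by simpa using activationTime_le_sum (ω := ω) (z := fun _ : Fin 1 => 0) rfl)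
    zero_le

theorem activationTime_le_add (ω : Config d) (x y : Site d) :
    activationTime ω y ≤ activationTime ω x + hitTime ω x y := by
  rcases eq_or_ne (activationTime ω x) ⊤ with h | h
  · rw [h, top_add]
    exact le_top
  obtain ⟨m, z, h0, rfl, hsum⟩ := exists_activationTime_eq_sum h
  have hsnoc := activationTime_le_sum (ω := ω) (z := Fin.snoc z y)
    (by rw [← Fin.castSucc_zero, Fin.snoc_castSucc, h0])
  rw [hsum]
  simpa only [Fin.snoc_last, Fin.sum_univ_castSucc, Fin.succ_last, ← Fin.castSucc_succ,
    Fin.snoc_castSucc] using hsnoc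

theorem eq_zero_or_exists_activationTime_add_le {n : ℕ} (h : activationTime ω y ≤ n) :
    y = 0 ∨ ∃ x, hitTime ω x y ≠ 0 ∧ activationTime ω x + hitTime ω x y ≤ n := by
  obtain ⟨m, z, h0, rfl, hsum⟩ :=
    exists_activationTime_eq_sum (ne_top_of_le_ne_top (ENat.natCast_ne_top n) h)
  rw [hsum] at h
  clear hsum
  induction m with
  | zero => exact Or.inl h0
  | succ m ih =>
    rw [Fin.sum_univ_castSucc, Fin.succ_last] at h
    by_cases hlast : hitTime ω (z (Fin.last m).castSucc) (z (Fin.last (m + 1))) = 0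
    · rw [hlast, add_zero] at h
      rw [← eq_of_hitTime_eq_zero hlast]
      exact ih (fun j => z j.castSucc) h0 h
    · exact Or.inr ⟨_, hlast, (add_le_add_left (activationTime_le_sum
        (z := fun j => z j.castSucc) h0) _).trans h⟩

theorem finite_activationTime_le (ω : Config d) (n : ℕ) : {y | activationTime ω y ≤ n}.Finite := by
  induction n with
  | zero =>
    refine (Set.finite_singleton 0).subset fun y hy => ?_
    refine (eq_zero_or_exists_activationTime_add_le hy).resolve_right fun ⟨x, hne, hle⟩ => hne ?_
    exact nonpos_iff_eq_zero.1 (le_add_self.trans hle)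
  | succ n ih =>
    refine ((Set.finite_singleton 0).union
      (ih.biUnion fun x _ => finite_hitTime_le ω x (n + 1))).subset fun y hy => ?_
    refine (eq_zero_or_exists_activationTime_add_le hy).imp_right fun ⟨x, hne, hle⟩ => ?_
    refine Set.mem_biUnion (?_ : activationTime ω x ≤ n) (le_add_self.trans hle)
    have hone : activationTime ω x + 1 ≤ n + 1 :=
      (add_le_add_right (Order.one_le_iff_ne_zero.2 hne) _).trans (by exact_mod_cast hle)
    exact (ENat.add_le_add_iff_right ENat.one_ne_top).1 hone

/-- The sites visited in its first `N` steps by the first particle from `x`, provided that it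
exists and lives longer than `N`. -/
def frogOut (x : Site d) (v : Frog d N) : Set (Site d) :=
  {y | 1 ≤ v.1 ∧ v.2.1 ∈ hitSet {y} N x ∧ (N : ℕ∞) < v.2.2}

theorem walk_zero_eq_add_partialSum (ω : Config d) (x : Site d) (n : Fin (N + 1)) :
    walk ω x 0 n = x + Fin.partialSum (frogs N ω x).2.1 n := by
  rw [walk]
  congr 1
  induction n using Fin.induction with
  | zero => simp
  | succ n ih =>
    rw [Fin.partialSum_succ, ← ih, Fin.val_succ, Finset.sum_range_succ]
    rfl

theorem hitTime_lt_lifetime_of_mem_frogOut (h : y ∈ frogOut x (frogs N ω x)) :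
    hitTime ω x y < lifetime ω x 0 := by
  obtain ⟨hcount, ⟨-, n, hn⟩, hlife⟩ := h
  have hle : ((n : ℕ) : ℕ∞) ≤ N := by exact_mod_cast n.is_le
  exact (hitTime_le hcount (hle.trans_lt hlife)
    ((walk_zero_eq_add_partialSum ω x n).trans hn)).trans_lt (hle.trans_lt hlife)

theorem exists_isActive_of_mem_cluster {n : ℕ} (hy : y ∈ cluster frogOut 0 (frogs N ω))
    (hn : (n : ℕ∞) < activationTime ω y) : ∃ x i, IsActive ω x i n := by
  induction hy with
  | refl => simp [activationTime_zero] at hn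
  | @tail x y _ hxy ih =>
    rcases le_or_gt (activationTime ω x) n with hx | hx
    · refine ⟨x, 0, hxy.1, hx, ?_⟩
      calc (n : ℕ∞) < activationTime ω y := hn
        _ ≤ activationTime ω x + hitTime ω x y := activationTime_le_add ω x y
        _ ≤ activationTime ω x + lifetime ω x 0 := by
          gcongr
          exact (hitTime_lt_lifetime_of_mem_frogOut hxy).le
    · exact ih hx

theorem survives_of_infinite_cluster (h : (cluster frogOut 0 (frogs N ω)).Infinite) :
    Survives ω := fun n => by
  obtain ⟨y, hy, hn⟩ := h.exists_notMem_finite (finite_activationTime_le ω n)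
  exact exists_isActive_of_mem_cluster hy (not_le.1 hn)

theorem isStepConnected_cluster (v : Site d → Frog d N) :
    IsStepConnected (unitSteps d) (cluster frogOut 0 v) := fun y hy => by
  induction hy with
  | refl => exact .refl
  | @tail x y hx hxy ih =>
    obtain ⟨hcount, ⟨hunit, n, rfl⟩, hlife⟩ := hxy
    have hmem : ∀ m, x + Fin.partialSum (v x).2.1 m ∈ cluster frogOut 0 v := fun m =>
      mem_cluster_of_mem_out hx ⟨hcount, ⟨hunit, m, rfl⟩, hlife⟩
    refine ih.trans ?_
    clear ih
    induction n using Fin.induction with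
    | zero => simp [Relation.ReflTransGen.refl]
    | succ n ih =>
      refine ih.tail ⟨hmem _, hmem _, ?_⟩
      rw [Fin.partialSum_succ, add_sub_add_left_eq_sub, add_sub_cancel_left]
      exact hunit n

end Activation

section Blocks

variable {d r : ℕ} {i₀ i₁ : Fin d}

/-- The index of the block of side `r` that contains the projection of `x` to the plane of
the axes `i₀` and `i₁`. -/
def block (i₀ i₁ : Fin d) (r : ℕ) (x : Site d) : ℤ × ℤ := (x i₀ / r, x i₁ / r)

/-- The block of `x` is within sup-distance one of `b`. -/
def NearBlock (i₀ i₁ : Fin d) (r : ℕ) (x : Site d) (b : ℤ × ℤ) : Prop :=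
  |b.1 - (block i₀ i₁ r x).1| ≤ 1 ∧ |b.2 - (block i₀ i₁ r x).2| ≤ 1

/-- The sup-distance between the projections of `x` and `y` to the plane of the axes `i₀` and
`i₁`; connected sets of sites take all intermediate values of it. -/
def planarDist (i₀ i₁ : Fin d) (x y : Site d) : ℤ := max |x i₀ - y i₀| |x i₁ - y i₁|

theorem abs_ediv_sub_ediv_le (hr : 0 < r) {a b : ℤ} (h : |a - b| ≤ r) : |a / r - b / r| ≤ 1 := by
  have hr' : (0 : ℤ) < r := by exact_mod_cast hr
  have ediv_le_add_one (a b : ℤ) (hab : a ≤ b + r) : a / r ≤ b / r + 1 :=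
    calc a / r ≤ (b + r) / r := Int.ediv_le_ediv hr' hab
      _ = b / r + 1 := by rw [Int.add_ediv_of_dvd_right dvd_rfl, Int.ediv_self hr'.ne']
  rw [abs_le] at h ⊢
  have hab := ediv_le_add_one a b (by omega)
  have hba := ediv_le_add_one b a (by omega)
  omega

theorem nearBlock_of_planarDist_le (hr : 0 < r) {x y : Site d} (h : planarDist i₀ i₁ y x ≤ r) :
    NearBlock i₀ i₁ r x (block i₀ i₁ r y) :=
  ⟨abs_ediv_sub_ediv_le hr ((le_max_left _ _).trans h),
    abs_ediv_sub_ediv_le hr ((le_max_right _ _).trans h)⟩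

theorem block_eq_or_sub_mem_planarSteps (hr : 0 < r) (hi : i₀ ≠ i₁) {x y : Site d}
    (h : y - x ∈ unitSteps d) :
    block i₀ i₁ r y = block i₀ i₁ r x ∨ block i₀ i₁ r y - block i₀ i₁ r x ∈ planarSteps := by
  obtain ⟨q, hq⟩ := exists_eq_unitStep h
  have coord (j : Fin d) : |y j - x j| ≤ r ∧ (y j = x j ∨ j = q.1) := by
    have hj := congrFun hq j
    rw [Pi.sub_apply, unitStep_apply] at hj
    rw [abs_le]
    split_ifs at hj <;> omega
  have hfix : y i₀ = x i₀ ∨ y i₁ = x i₁ :=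
    (coord i₀).2.imp_right fun h₀ => (coord i₁).2.resolve_right fun h₁ => hi (h₀.trans h₁.symm)
  have hdiv (j : Fin d) := abs_le.1 (abs_ediv_sub_ediv_le hr (coord j).1)
  have hdiv₀ := hdiv i₀
  have hdiv₁ := hdiv i₁
  simp only [mem_planarSteps, block, Prod.ext_iff, Prod.fst_sub, Prod.snd_sub]
  rcases hfix with hj | hj <;> rw [hj] at * <;> omega

theorem IsStepConnected.image_block {C : Set (Site d)} (hC : IsStepConnected (unitSteps d) C)
    (hr : 0 < r) (hi : i₀ ≠ i₁) : IsStepConnected planarSteps (block i₀ i₁ r '' C) := by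
  rintro _ ⟨y, hy, rfl⟩
  have hpath := hC y hy
  clear hy
  induction hpath with
  | refl => simp [block, ← Prod.zero_eq_mk, Relation.ReflTransGen.refl]
  | tail _ h ih =>
    rcases block_eq_or_sub_mem_planarSteps hr hi h.2.2 with he | he
    · rwa [he]
    · exact ih.tail ⟨⟨_, h.1, rfl⟩, ⟨_, h.2.1, rfl⟩, he⟩

theorem exists_reflTransGen_eq_of_le_add_one {α : Type*} {R : α → α → Prop} {f : α → ℤ}
    (hf : ∀ x y, R x y → f y ≤ f x + 1) {x y : α} (h : Relation.ReflTransGen R x y) {t : ℤ}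
    (hx : f x ≤ t) (hy : t ≤ f y) : ∃ z, Relation.ReflTransGen R x z ∧ f z = t := by
  induction h with
  | refl => exact ⟨x, .refl, hx.antisymm hy⟩
  | @tail y z hxy hyz ih =>
    by_cases hty : t ≤ f y
    · exact ih hty
    · exact ⟨z, hxy.tail hyz, by have := hf y z hyz; omega⟩

theorem neg_mem_unitSteps {e : Site d} (he : e ∈ unitSteps d) : -e ∈ unitSteps d :=
  (Finset.sum_congr rfl fun j _ => abs_neg (e j)).trans he

theorem StepIn.symm {G : Type*} [AddGroup G] {S C : Set G} (hS : ∀ e ∈ S, -e ∈ S) {x y : G}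
    (h : StepIn S C x y) : StepIn S C y x :=
  ⟨h.2.1, h.1, neg_sub y x ▸ hS _ h.2.2⟩

theorem mem_of_reflTransGen_stepIn {G : Type*} [AddGroup G] {S C : Set G} {x y : G} (hx : x ∈ C)
    (h : Relation.ReflTransGen (StepIn S C) x y) : y ∈ C := by
  cases h with
  | refl => exact hx
  | tail _ h => exact h.2.1

theorem planarDist_le_add_one {x y : Site d} (z : Site d) (h : y - x ∈ unitSteps d) :
    planarDist i₀ i₁ z y ≤ planarDist i₀ i₁ z x + 1 := by
  have hstep (j : Fin d) : |x j - y j| ≤ 1 := by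
    rw [abs_sub_comm]
    exact (Finset.single_le_sum (f := fun j => |(y - x) j|) (fun i _ => abs_nonneg _)
      (Finset.mem_univ j)).trans_eq h
  have coord (j : Fin d) : |z j - y j| ≤ |z j - x j| + 1 :=
    (abs_sub_le _ (x j) _).trans (by gcongr; exact hstep j)
  exact max_le ((coord i₀).trans (by gcongr; exact le_max_left _ _))
    ((coord i₁).trans (by gcongr; exact le_max_right _ _))

theorem exists_reflTransGen_le_planarDist {C : Set (Site d)}
    (hC : IsStepConnected (unitSteps d) C) {z : Site d} (hz : z ∈ C) (hzr : 2 * r ≤ z i₀)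
    {y : Site d} (hy : y ∈ C) :
    ∃ w, Relation.ReflTransGen (StepIn (unitSteps d) C) y w ∧ r ≤ planarDist i₀ i₁ y w := by
  have hy₀ : Relation.ReflTransGen (StepIn (unitSteps d) C) y 0 :=
    have : Std.Symm (StepIn (unitSteps d) C) := ⟨fun _ _ => StepIn.symm fun _ => neg_mem_unitSteps⟩
    Relation.ReflTransGen.stdSymm.symm _ _ (hC y hy)
  rcases le_or_gt (r : ℤ) |y i₀| with h | h
  · exact ⟨0, hy₀, h.trans (le_trans (by simp) (le_max_left _ _))⟩
  · refine ⟨z, hy₀.trans (hC z hz), le_trans ?_ (le_max_left _ _)⟩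
    rw [abs_sub_comm]
    exact le_trans (by have := abs_lt.1 h; omega) (le_abs_self _)

open Classical in
theorem le_card_nearBlock (hr : 0 < r) {A : Finset (Site d)}
    (hA : IsStepConnected (unitSteps d) (A : Set (Site d))) {z : Site d} (hz : z ∈ A)
    (hzr : 2 * r ≤ z i₀) {y : Site d} (hy : y ∈ A) :
    r ≤ {x ∈ A.erase 0 | NearBlock i₀ i₁ r x (block i₀ i₁ r y)}.card := by
  let near := {x ∈ A | NearBlock i₀ i₁ r x (block i₀ i₁ r y)}
  obtain ⟨w, hyw, hrw⟩ := exists_reflTransGen_le_planarDist (i₁ := i₁) hA hz hzr hy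
  have hdist : Finset.Icc (0 : ℤ) r ⊆ near.image (planarDist i₀ i₁ y) := fun t ht => by
    rw [Finset.mem_Icc] at ht
    obtain ⟨x, hyx, hxt⟩ := exists_reflTransGen_eq_of_le_add_one
      (f := planarDist i₀ i₁ y) (fun _ _ h => planarDist_le_add_one y h.2.2) hyw
      (by simpa [planarDist] using ht.1) (ht.2.trans hrw)
    exact Finset.mem_image.2 ⟨x, Finset.mem_filter.2 ⟨mem_of_reflTransGen_stepIn hy hyx,
      nearBlock_of_planarDist_le hr (hxt.trans_le ht.2)⟩, hxt⟩
  have hcard : r + 1 ≤ near.card := by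
    simpa using (Finset.card_le_card hdist).trans Finset.card_image_le
  rw [Finset.filter_erase]
  exact (Nat.le_sub_one_of_lt hcard).trans Finset.pred_card_le_card_erase

open Classical in
theorem card_mul_le_card_nearBlock_mul {A : Finset (Site d)} {l : Finset PlanarEdge}
    (hl : ∀ e ∈ l, e.2 - e.1 ∈ planarSteps)
    (h : ∀ e ∈ l, r ≤ {x ∈ A | NearBlock i₀ i₁ r x e.1}.card) :
    l.card * r ≤ {x ∈ A | ∃ e ∈ l, NearBlock i₀ i₁ r x e.1}.card * 36 := by
  refine Finset.card_mul_le_card_mul (fun e x => NearBlock i₀ i₁ r x e.1)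
    (fun e he => (h e he).trans (Finset.card_le_card fun x hx => ?_)) fun x _ => ?_
  · rw [Finset.mem_filter] at hx
    exact Finset.mem_filter.2 ⟨Finset.mem_filter.2 ⟨hx.1, e, he, hx.2⟩, hx.2⟩
  · refine (Finset.card_le_card fun e he => ?_).trans (card_edgesNear_le (block i₀ i₁ r x))
    rw [Finset.mem_bipartiteBelow] at he
    exact mem_edgesNear he.2.1 he.2.2 (hl e he.1)

theorem ediv_eq_of_abs_sub_lt {h : ℕ} {a b : ℤ} (hab : |a - (b * (2 * h) + h)| < h) :
    a / (2 * h : ℕ) = b := by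
  rw [abs_lt] at hab
  have hpos : (0 : ℤ) < (2 * h : ℕ) := by omega
  refine le_antisymm (Int.lt_add_one_iff.1 ((Int.ediv_lt_iff_lt_mul hpos).2 ?_))
    ((Int.le_ediv_iff_mul_le hpos).2 ?_) <;> push_cast <;> linarith

theorem abs_sub_le_of_abs_ediv_sub_le {h : ℕ} (hh : 0 < h) {a b : ℤ}
    (hab : |a / (2 * h : ℕ) - b| ≤ 2) : |a - (b * (2 * h) + h)| ≤ 5 * h := by
  have hpos : (0 : ℤ) < (2 * h : ℕ) := by omega
  have hdiv := Int.emod_add_mul_ediv a (2 * h : ℕ)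
  have hmod := Int.emod_nonneg a hpos.ne'
  have hmod' := Int.emod_lt_of_pos a hpos
  push_cast at *
  rw [abs_le] at hab ⊢
  constructor <;> nlinarith

theorem block_eq_of_planarDistSq_lt {h : ℕ} {b : ℤ × ℤ} {z : Site d}
    (hz : planarDistSq i₀ i₁ (b.1 * (2 * h) + h, b.2 * (2 * h) + h) z < h ^ 2) :
    block i₀ i₁ (2 * h) z = b := by
  rw [planarDistSq] at hz
  refine Prod.ext (ediv_eq_of_abs_sub_lt ?_) (ediv_eq_of_abs_sub_lt ?_) <;>
    refine abs_lt_of_sq_lt_sq (lt_of_le_of_lt ?_ hz) h.cast_nonneg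
  · exact le_add_of_nonneg_right (sq_nonneg _)
  · exact le_add_of_nonneg_left (sq_nonneg _)

theorem planarDistSq_le_of_nearBlock {h : ℕ} (hh : 0 < h) {e : PlanarEdge}
    (he : e.2 - e.1 ∈ planarSteps) {x : Site d} (hx : NearBlock i₀ i₁ (2 * h) x e.1) :
    planarDistSq i₀ i₁ (e.2.1 * (2 * h) + h, e.2.2 * (2 * h) + h) x ≤ 50 * h ^ 2 := by
  have hnear : |(block i₀ i₁ (2 * h) x).1 - e.2.1| ≤ 2 ∧
      |(block i₀ i₁ (2 * h) x).2 - e.2.2| ≤ 2 := by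
    obtain ⟨hx₁, hx₂⟩ := hx
    simp only [mem_planarSteps, Prod.ext_iff, Prod.fst_sub, Prod.snd_sub] at he
    rw [abs_le] at *
    rw [abs_le] at *
    omega
  have h₁ := sq_le_sq' (abs_le.1 (abs_sub_le_of_abs_ediv_sub_le hh hnear.1)).1
    (abs_le.1 (abs_sub_le_of_abs_ediv_sub_le hh hnear.1)).2
  have h₂ := sq_le_sq' (abs_le.1 (abs_sub_le_of_abs_ediv_sub_le hh hnear.2)).1
    (abs_le.1 (abs_sub_le_of_abs_ediv_sub_le hh hnear.2)).2
  rw [planarDistSq]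
  linarith

/-- A lower bound, uniform in the scale, for the probability that a walk started near a block
enters a given neighbour of that block. -/
def blockHitConst : ENNReal := ENNReal.ofReal (Real.exp (-150) - Real.exp (-151))

theorem blockHitConst_pos : 0 < blockHitConst := by
  simp only [blockHitConst, ENNReal.ofReal_pos, sub_pos, Real.exp_lt_exp]
  norm_num

theorem exists_blockHitConst_le {h : ℕ} (hh : 3 ≤ h) (hi : i₀ ≠ i₁) :
    ∃ N₀ : ℕ, ∀ N ≥ N₀, ∀ (e : PlanarEdge) (x : Site d), e.2 - e.1 ∈ planarSteps →
      NearBlock i₀ i₁ (2 * h) x e.1 →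
        blockHitConst ≤ stepsLaw d N (hitSet {z | block i₀ i₁ (2 * h) z = e.2} N x) := by
  have hh' : (3 : ℝ) ≤ h := by exact_mod_cast hh
  have hsq : (0 : ℝ) < h ^ 2 := by positivity
  obtain ⟨N₀, hN₀⟩ := exists_exp_sub_exp_le_stepsLaw_hitSet hi (s := 3 / h ^ 2) (by positivity)
    (by rw [div_le_div_iff₀ hsq two_pos]; nlinarith) 150 151
  refine ⟨N₀, fun N hN e x he hx => ENNReal.ofReal_le_of_le_toReal
    (hN₀ N hN (e.2.1 * (2 * h) + h, e.2.2 * (2 * h) + h) _ (fun z hz => ?_) x ?_)⟩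
  · refine block_eq_of_planarDistSq_lt ?_
    rw [div_mul_eq_mul_div, div_lt_iff₀ hsq] at hz
    exact_mod_cast lt_of_mul_lt_mul_left hz zero_le_three
  · have hdist : (planarDistSq i₀ i₁ (e.2.1 * (2 * h) + h, e.2.2 * (2 * h) + h) x : ℝ) ≤
        50 * h ^ 2 := by exact_mod_cast planarDistSq_le_of_nearBlock (by omega) he hx
    rw [div_mul_eq_mul_div, div_le_iff₀ hsq]
    linarith

end Blocks

section Percolation

variable {d N r L : ℕ} {i₀ i₁ : Fin d}

/-- The reduced configurations of a site whose first particle lives longer than `N` and always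
steps forward along the axis `i₀`. -/
def straightSet (N : ℕ) (i₀ : Fin d) : Set (Frog d N) :=
  {n | 1 ≤ n} ×ˢ {fun _ => unitStep (i₀, true)} ×ˢ Set.Ioi (N : ℕ∞)

/-- The reduced configurations of the site `x` whose first particle enters `B`. -/
def enterSet (N : ℕ) (B : Set (Site d)) (x : Site d) : Set (Frog d N) :=
  {n | 1 ≤ n} ×ˢ hitSet B N x ×ˢ Set.Ioi (N : ℕ∞)

theorem nsmul_mem_frogOut_of_mem_straightSet {v : Frog d N} (hv : v ∈ straightSet N i₀) {n : ℕ}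
    (hn : n ≤ N) : n • unitStep (i₀, true) ∈ frogOut 0 v := by
  obtain ⟨hcount, hsteps, hlife⟩ := hv
  rw [Set.mem_singleton_iff] at hsteps
  refine ⟨hcount, ⟨fun _ => hsteps ▸ unitStep_mem _, ⟨n, Nat.lt_succ_of_le hn⟩, ?_⟩, hlife⟩
  rw [hsteps, zero_add, Set.mem_singleton_iff]
  clear hsteps hlife hcount
  induction n with
  | zero => simp
  | succ n ih =>
    rw [succ_nsmul, ← ih (by omega)]
    exact Fin.partialSum_succ _ ⟨n, hn⟩

theorem exists_mem_frogOut_of_mem_enterSet {B : Set (Site d)} {x : Site d} {v : Frog d N}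
    (hv : v ∈ enterSet N B x) : ∃ y ∈ B, y ∈ frogOut x v := by
  obtain ⟨hcount, ⟨hunit, n, hn⟩, hlife⟩ := hv
  exact ⟨_, hn, hcount, ⟨hunit, n, rfl⟩, hlife⟩

/-- From a site near a block, the first particle fails to enter a given neighbour of that block
with probability at most `β`. -/
def IsBlockFailureBound (i₀ i₁ : Fin d) (r : ℕ) (μ : Measure (Frog d N)) (β : ENNReal) : Prop :=
  ∀ (e : PlanarEdge) (x : Site d), e.2 - e.1 ∈ planarSteps → NearBlock i₀ i₁ r x e.1 →
    μ (enterSet N {z | block i₀ i₁ r z = e.2} x)ᶜ ≤ β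

/-- The configurations in which the first particle of the origin goes straight and the cluster of
the origin is finite, all edges in `l` being boundary edges of its block projection. -/
def blockedSet (i₀ i₁ : Fin d) (r N : ℕ) (l : List PlanarEdge) : Set (Site d → Frog d N) :=
  {v | v 0 ∈ straightSet N i₀ ∧ ∃ A : Finset (Site d), cluster frogOut 0 v = A ∧
    ∀ e ∈ l, IsBoundaryEdge (block i₀ i₁ r '' A) e}

/-- The constraint that `blockedSet` puts on the reduced configuration of a site `x` of the
cluster. -/
def siteConstraint (i₀ i₁ : Fin d) (r N : ℕ) (l : List PlanarEdge) (x : Site d) :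
    Set (Frog d N) :=
  {v | (x = 0 → v ∈ straightSet N i₀) ∧ (x ≠ 0 → ∀ e ∈ l, NearBlock i₀ i₁ r x e.1 →
    v ∉ enterSet N {z | block i₀ i₁ r z = e.2} x)}

open Classical in
/-- Upper bounds for the probabilities of the sets `siteConstraint`. -/
def siteWeight (i₀ i₁ : Fin d) (r : ℕ) (g β : ENNReal) (l : List PlanarEdge) (x : Site d) :
    ENNReal :=
  if x = 0 then g else if ∃ e ∈ l.toFinset, NearBlock i₀ i₁ r x e.1 then β else 1

section Blocked

variable {μ : Measure (Frog d N)} {g β : ENNReal} {l : List PlanarEdge}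

theorem measure_siteConstraint_le [IsProbabilityMeasure μ]
    (hβ : IsBlockFailureBound i₀ i₁ r μ β) (hl : ∀ e ∈ l, e.2 - e.1 ∈ planarSteps) (x : Site d) :
    μ (siteConstraint i₀ i₁ r N l x) ≤ siteWeight i₀ i₁ r (μ (straightSet N i₀)) β l x := by
  rw [siteWeight]
  split_ifs with hx hnear
  · exact measure_mono fun v hv => hv.1 hx
  · obtain ⟨e, he, hxe⟩ := hnear
    rw [List.mem_toFinset] at he
    exact (measure_mono fun v hv => hv.2 hx e he hxe).trans (hβ e x (hl e he) hxe)
  · exact prob_le_one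

theorem mem_siteConstraint {v : Site d → Frog d N} (hv : v 0 ∈ straightSet N i₀)
    (hl : ∀ e ∈ l, IsBoundaryEdge (block i₀ i₁ r '' cluster frogOut 0 v) e) {x : Site d}
    (hx : x ∈ cluster frogOut 0 v) : v x ∈ siteConstraint i₀ i₁ r N l x := by
  refine ⟨fun h => h ▸ hv, fun _ e he _ henter => (hl e he).2.1 ?_⟩
  obtain ⟨y, hy, hxy⟩ := exists_mem_frogOut_of_mem_enterSet henter
  exact ⟨y, mem_cluster_of_mem_out hx hxy, hy⟩

open Classical in
theorem prod_siteWeight {A : Finset (Site d)} (h0 : 0 ∈ A) :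
    ∏ x ∈ A, siteWeight i₀ i₁ r g β l x =
      g * β ^ {x ∈ A.erase 0 | ∃ e ∈ l.toFinset, NearBlock i₀ i₁ r x e.1}.card := by
  rw [← Finset.mul_prod_erase A _ h0, siteWeight, if_pos rfl, ← Finset.prod_const,
    Finset.prod_filter]
  exact congrArg _ (Finset.prod_congr rfl fun x hx => if_neg (Finset.ne_of_mem_erase hx))

open Classical in
theorem length_mul_le_card_nearBlock (hL : 0 < L) (hrL : 36 * L ≤ r) (hN : 2 * r ≤ N)
    {v : Site d → Frog d N} (hv : v 0 ∈ straightSet N i₀) {A : Finset (Site d)}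
    (hA : cluster frogOut 0 v = A) (hnodup : l.Nodup)
    (hl : ∀ e ∈ l, IsBoundaryEdge (block i₀ i₁ r '' A) e) :
    l.length * L ≤
      {x ∈ A.erase 0 | ∃ e ∈ l.toFinset, NearBlock i₀ i₁ r x e.1}.card := by
  have hfar : (2 * r) • unitStep (i₀, true) ∈ A := by
    rw [← Finset.mem_coe, ← hA]
    exact mem_cluster_of_mem_out (mem_cluster_self v) (nsmul_mem_frogOut_of_mem_straightSet hv hN)
  have hedges (e : PlanarEdge) (he : e ∈ l.toFinset) := hl e (List.mem_toFinset.1 he)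
  have hnear : ∀ e ∈ l.toFinset, r ≤ {x ∈ A.erase 0 | NearBlock i₀ i₁ r x e.1}.card := by
    intro e he
    obtain ⟨y, hy, hye⟩ := (hedges e he).1
    rw [← hye]
    exact le_card_nearBlock (by omega) (hA ▸ isStepConnected_cluster v) hfar
      (by simp [unitStep_apply]) hy
  have hcount := card_mul_le_card_nearBlock_mul (fun e he => (hedges e he).2.2) hnear
  rw [List.toFinset_card_of_nodup hnodup] at hcount
  nlinarith [Nat.mul_le_mul_left l.length hrL]

theorem infinitePi_blockedSet_le [IsProbabilityMeasure μ] (hL : 0 < L) (hrL : 36 * L ≤ r)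
    (hN : 2 * r ≤ N) (hβ : IsBlockFailureBound i₀ i₁ r μ β) (hβ1 : β ≤ 1) (hnodup : l.Nodup) :
    Measure.infinitePi (fun _ : Site d => μ) (blockedSet i₀ i₁ r N l) ≤
      μ (straightSet N i₀) * (β ^ L) ^ l.length := by
  by_cases hl : ∀ e ∈ l, e.2 - e.1 ∈ planarSteps
  · refine le_trans (measure_mono ?_) (infinitePi_cluster_le (out := frogOut) (o := 0)
      (fun _ => μ) (measure_siteConstraint_le hβ hl) _)
    rintro v ⟨hv, A, hA, hb⟩
    refine ⟨A, hA, fun x hx => mem_siteConstraint hv (hA ▸ hb) (hA ▸ hx), ?_⟩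
    rw [prod_siteWeight (Finset.mem_coe.1 (hA ▸ mem_cluster_self v)), ← pow_mul, mul_comm L]
    exact mul_le_mul_right (pow_le_pow_right_of_le_one' hβ1
      (length_mul_le_card_nearBlock hL hrL hN hv hA hnodup hb)) _
  · have hempty : blockedSet i₀ i₁ r N l = ∅ := Set.eq_empty_of_forall_notMem
      fun v ⟨_, A, _, hb⟩ => hl fun e he => (hb e he).2.2
    rw [hempty, measure_empty]
    exact zero_le

end Blocked

/-- The chains of distinct edges that may occur in the boundary of a finite connected set of
blocks that contains the blocks `(0, 0), …, (k, 0)` but not the block `(k + 1, 0)`. -/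
def contours (k : ℕ) : Finset (List PlanarEdge) :=
  {l ∈ chains (fun e : PlanarEdge => edgesNear e.1) k ((k, 0), (k + 1, 0)) |
    l.length = k + 1 ∧ l.Nodup}

theorem card_contours_le (k : ℕ) : (contours k).card ≤ 36 ^ k :=
  (Finset.card_filter_le _ _).trans
    (card_chains_le (c := 36) (fun e : PlanarEdge => card_edgesNear_le e.1) k _)

theorem infinite_cluster_or_mem_blockedSet (hr : 0 < r) (hi : i₀ ≠ i₁)
    {v : Site d → Frog d N} (hv : v 0 ∈ straightSet N i₀) :
    (cluster frogOut 0 v).Infinite ∨ ∃ k, ∃ l ∈ contours k, v ∈ blockedSet i₀ i₁ r N l := by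
  refine or_iff_not_imp_left.2 fun hfin => ?_
  obtain ⟨A, hA⟩ := (Set.not_infinite.1 hfin).exists_finset_coe
  obtain ⟨k, l, hl, hlen, hnodup, hb⟩ := exists_chain_boundaryEdge
    (A.finite_toSet.image (block i₀ i₁ r)) ⟨0, hA ▸ mem_cluster_self v, by simp [block]⟩
    (hA ▸ (isStepConnected_cluster v).image_block hr hi)
  exact ⟨k, l, Finset.mem_filter.2 ⟨hl, hlen, hnodup⟩, hv, A, hA.symm, hb⟩

theorem tsum_pow_mul_pow_succ_lt_one {γ : ENNReal} (hγ : 36 * γ ≤ 2⁻¹) :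
    ∑' k : ℕ, 36 ^ k * γ ^ (k + 1) < 1 :=
  calc ∑' k : ℕ, 36 ^ k * γ ^ (k + 1) = ∑' k : ℕ, γ * (36 * γ) ^ k := by
        refine tsum_congr fun k => ?_
        rw [mul_pow, pow_succ]
        ring
    _ ≤ ∑' k : ℕ, γ * 2⁻¹ ^ k := by gcongr
    _ = γ * 2 := by
        rw [ENNReal.tsum_mul_left, ENNReal.tsum_geometric, ENNReal.one_sub_inv_two, inv_inv]
    _ ≤ 36 * γ := by rw [mul_comm]; gcongr; norm_num
    _ < 1 := hγ.trans_lt ENNReal.one_half_lt_one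

theorem infinitePi_infinite_cluster_pos {μ : Measure (Frog d N)} [IsProbabilityMeasure μ]
    {β : ENNReal} (hL : 0 < L) (hrL : 36 * L ≤ r) (hN : 2 * r ≤ N) (hi : i₀ ≠ i₁)
    (hβ : IsBlockFailureBound i₀ i₁ r μ β) (hβ1 : β ≤ 1) (hβL : 36 * β ^ L ≤ 2⁻¹)
    (hstraight : μ (straightSet N i₀) ≠ 0) :
    0 < Measure.infinitePi (fun _ : Site d => μ) {v | (cluster frogOut 0 v).Infinite} := by
  set P := Measure.infinitePi fun _ : Site d => μ
  set g := μ (straightSet N i₀)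
  have horigin : P {v | v 0 ∈ straightSet N i₀} = g :=
    (measurePreserving_eval_infinitePi (fun _ : Site d => μ) 0).measure_preimage
      (Set.to_countable _).measurableSet.nullMeasurableSet
  have hcover : {v | v 0 ∈ straightSet N i₀} ⊆ {v | (cluster frogOut 0 v).Infinite} ∪
      ⋃ k, ⋃ l ∈ contours k, blockedSet i₀ i₁ r N l := fun v hv =>
    (infinite_cluster_or_mem_blockedSet (by omega) hi hv).imp_right fun ⟨k, l, hl, hvl⟩ =>
      Set.mem_iUnion.2 ⟨k, Set.mem_biUnion hl hvl⟩
  have hcontours (k : ℕ) : P (⋃ l ∈ contours k, blockedSet i₀ i₁ r N l) ≤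
      g * (36 ^ k * (β ^ L) ^ (k + 1)) := by
    refine (measure_biUnion_finset_le _ _).trans ((Finset.sum_le_card_nsmul _ _
      (g * (β ^ L) ^ (k + 1)) fun l hl => ?_).trans ?_)
    · obtain ⟨hlen, hnodup⟩ := (Finset.mem_filter.1 hl).2
      exact hlen ▸ infinitePi_blockedSet_le hL hrL hN hβ hβ1 hnodup
    · rw [nsmul_eq_mul, mul_left_comm]
      gcongr
      exact_mod_cast card_contours_le k
  have hblocked : P (⋃ k, ⋃ l ∈ contours k, blockedSet i₀ i₁ r N l) < g :=
    calc _ ≤ ∑' k, P (⋃ l ∈ contours k, blockedSet i₀ i₁ r N l) := measure_iUnion_le _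
      _ ≤ ∑' k : ℕ, g * (36 ^ k * (β ^ L) ^ (k + 1)) := ENNReal.tsum_le_tsum hcontours
      _ = g * ∑' k : ℕ, 36 ^ k * (β ^ L) ^ (k + 1) := ENNReal.tsum_mul_left
      _ < g * 1 := (ENNReal.mul_lt_mul_iff_right hstraight (measure_ne_top _ _)).2
          (tsum_pow_mul_pow_succ_lt_one hβL)
      _ = g := mul_one g
  refine pos_of_ne_zero fun hzero => hblocked.not_ge ?_
  calc g = P {v | v 0 ∈ straightSet N i₀} := horigin.symm
    _ ≤ P {v | (cluster frogOut 0 v).Infinite} +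
        P (⋃ k, ⋃ l ∈ contours k, blockedSet i₀ i₁ r N l) :=
      (measure_mono hcover).trans (measure_union_le _ _)
    _ = _ := by rw [hzero, zero_add]

end Percolation

section Survival

variable {d N : ℕ} {i₀ i₁ : Fin d} {ν : Measure ℕ}

theorem exists_isBlockFailureBound_frogLaw (hi : i₀ ≠ i₁) (ν : Measure ℕ)
    [IsProbabilityMeasure ν] {h : ℕ} (hh : 3 ≤ h) :
    ∃ N₀ : ℕ, ∀ N ≥ N₀, ∀ p : unitInterval, N * (1 - (p : ℝ)) ≤ 1 / 2 →
      IsBlockFailureBound i₀ i₁ (2 * h) (frogLaw d N ν p)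
        (1 - ν {n | 1 ≤ n} * (blockHitConst * 2⁻¹)) := by
  obtain ⟨N₀, hN₀⟩ := exists_blockHitConst_le hh hi
  refine ⟨N₀, fun N hN p hp e x he hx => ?_⟩
  have := isProbabilityMeasure_frogLaw i₀.pos N ν p
  rw [prob_compl_eq_one_sub (Set.to_countable _).measurableSet]
  refine tsub_le_tsub_left (le_trans ?_ (mul_le_frogLaw_prod i₀.pos hp _)) _
  gcongr
  exact hN₀ N hN e x he hx

theorem frogLaw_straightSet_ne_zero [IsProbabilityMeasure ν] (hν : 0 < ν {n | 1 ≤ n})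
    (i₀ : Fin d) {p : unitInterval} (hp : N * (1 - (p : ℝ)) ≤ 1 / 2) :
    frogLaw d N ν p (straightSet N i₀) ≠ 0 := by
  have := isProbabilityMeasure_stepLaw i₀.pos
  have hsteps : stepsLaw d N {fun _ => unitStep (i₀, true)} ≠ 0 := by
    rw [stepsLaw, Measure.pi_singleton, Finset.prod_ne_zero_iff]
    intro k _
    rw [stepLaw_singleton_unitStep]
    simp [ENNReal.mul_eq_top]
  refine ne_of_gt (lt_of_lt_of_le ?_ (mul_le_frogLaw_prod i₀.pos hp _))
  exact ENNReal.mul_pos hν.ne' (mul_ne_zero hsteps (by simp))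

theorem survivalProb_pos_of_infinite_cluster (hd : 0 < d) [IsProbabilityMeasure ν]
    {p : unitInterval} (h : 0 < Measure.infinitePi (fun _ : Site d => frogLaw d N ν p)
      {v | (cluster frogOut 0 v).Infinite}) : 0 < survivalProb d ν p := by
  have := isProbabilityMeasure_frogLaw hd N ν p
  rw [← (measurePreserving_frogs hd N ν p).measure_preimage
    measurableSet_infinite_cluster.nullMeasurableSet] at h
  exact h.trans_le (measure_mono fun ω hω => survives_of_infinite_cluster hω)

theorem exists_unitInterval_lt_one_mul_le (N : ℕ) :
    ∃ p₀ : unitInterval, p₀ < 1 ∧ ∀ p, p₀ < p → N * (1 - (p : ℝ)) ≤ 1 / 2 := by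
  have hN : (0 : ℝ) < 2 * (N + 1) := by positivity
  have hinv : 1 / (2 * ((N : ℝ) + 1)) ≤ 1 := by
    rw [div_le_one hN]
    linarith [N.cast_nonneg (α := ℝ)]
  refine ⟨⟨1 - 1 / (2 * (N + 1)), sub_nonneg.2 hinv, sub_le_self _ (by positivity)⟩,
    Subtype.coe_lt_coe.1 (sub_lt_self _ (by positivity)), fun p hp => ?_⟩
  have hp' : 1 - 1 / (2 * ((N : ℝ) + 1)) < p := hp
  calc N * (1 - (p : ℝ)) ≤ (N + 1) * (1 / (2 * (N + 1))) :=
        mul_le_mul (by linarith) (by linarith) (sub_nonneg.2 p.2.2) (by positivity)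
    _ = 1 / 2 := by field_simp

theorem exists_pos_mul_pow_le {c β ε : ENNReal} (hc : c ≠ ⊤) (hβ : β < 1) (hε : 0 < ε) :
    ∃ n, 0 < n ∧ c * β ^ n ≤ ε := by
  have hlim := ENNReal.Tendsto.const_mul (ENNReal.tendsto_pow_atTop_nhds_zero_of_lt_one hβ)
    (Or.inr hc)
  rw [mul_zero] at hlim
  exact ((Filter.eventually_gt_atTop 0).and (hlim.eventually_le_const hε)).exists

theorem exists_survivalProb_pos (ν : Measure ℕ) [IsProbabilityMeasure ν] (hν : 0 < ν {n | 1 ≤ n})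
    (d : ℕ) (hd : 2 ≤ d) :
    ∃ p₀ : unitInterval, p₀ < 1 ∧ ∀ p : unitInterval, p₀ < p → 0 < survivalProb d ν p := by
  have hd0 : 0 < d := by omega
  have hi : (⟨0, by omega⟩ : Fin d) ≠ ⟨1, by omega⟩ := by simp
  have hβ : 1 - ν {n | 1 ≤ n} * (blockHitConst * 2⁻¹) < 1 :=
    ENNReal.sub_lt_self ENNReal.one_ne_top one_ne_zero
      (mul_ne_zero hν.ne' (mul_ne_zero blockHitConst_pos.ne' (by simp)))
  obtain ⟨L, hL, hβL⟩ := exists_pos_mul_pow_le (c := 36) (ε := 2⁻¹) (by simp) hβ (by simp)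
  obtain ⟨N₀, hN₀⟩ := exists_isBlockFailureBound_frogLaw hi ν (h := 18 * L) (by omega)
  obtain ⟨N, hN₀N, hN⟩ : ∃ N ≥ N₀, 2 * (2 * (18 * L)) ≤ N :=
    ⟨_, le_max_left _ _, le_max_right _ _⟩
  obtain ⟨p₀, hp₀, hlife⟩ := exists_unitInterval_lt_one_mul_le N
  refine ⟨p₀, hp₀, fun p hp => ?_⟩
  have := isProbabilityMeasure_frogLaw hd0 N ν p
  exact survivalProb_pos_of_infinite_cluster hd0 (infinitePi_infinite_cluster_pos hL (by omega) hN
    hi (hN₀ N hN₀N p (hlife p hp)) hβ.le hβL (frogLaw_straightSet_ne_zero hν _ (hlife p hp)))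

end Survival

end

end FrogModel

theorem theorem2p4 {Ω : Type*} [MeasurableSpace Ω] (P : MeasureTheory.Measure Ω)
    [MeasureTheory.IsProbabilityMeasure P] (η : Ω → ℕ) (hη : Measurable η)
    (hpos : 0 < P {ω | 1 ≤ η ω}) (d : ℕ) (hd : 2 ≤ d) :
    FrogModel.criticalParam d (P.map η) < 1 ∧
      ∃ p₀ : unitInterval, p₀ < 1 ∧
        ∀ p : unitInterval, p₀ < p → 0 < FrogModel.survivalProb d (P.map η) p := by
  have hprob : MeasureTheory.IsProbabilityMeasure (P.map η) :=
    MeasureTheory.Measure.isProbabilityMeasure_map hη.aemeasurable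
  have hν : 0 < (P.map η) {n | 1 ≤ n} := by
    rwa [MeasureTheory.Measure.map_apply hη MeasurableSet.of_discrete]
  obtain ⟨p₀, hp₀, h⟩ := FrogModel.exists_survivalProb_pos (P.map η) hν d hd
  obtain ⟨p, hp, hp1⟩ := exists_between hp₀
  have hle : FrogModel.criticalParam d (P.map η) ≤ p := sInf_le (h p hp)
  exact ⟨hle.trans_lt hp1, p₀, hp₀, h⟩
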